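/- Let $1\le p<\infty$ and let $q\in(1,\infty]$ be its Hölder conjugate, $\frac1p+\frac1q=1$. There is a constant $C_p>0$, depending only on $p$, such that the following holds for all integers $m,n\ge 1$. Let $A$ be an $m\times n$ random matrix with i.i.d., mean-zero, unit-variance, sub-Gaussian entries, and let $K=\|A_{1,1}\|_{\psi_2}<\infty$, where, for a real random variable $Z$, $$\|Z\|_{\psi_2}=\inf\{t>0:\ \mathbb E\exp(Z^2/t^2)\le 2\}\in[0,\infty],\qquad \inf\emptyset=\infty .$$ Let $A_1$ be the first row of $A$, write $\|x\|=\|A_1x\|_{L^p}=(\mathbb E|A_1x|^p)^{1/p}$ for $x\in\mathbb R^n$, let $\partial B=\{x\in\mathbb R^n:\|x\|=1\}$, and set $$R_x=\|Ax\|_p-m^{1/p}\|A_1x\|_{L^p},\qquad X_x=\|Ax\|_p-\mathbb E\|Ax\|_p ,$$ where $\|\cdot\|_p$ is the $\ell_p$-norm on $\mathbb R^m$. Let $B_q^m=\{z\in\mathbb R^m:\|z\|_q\le1\}$ and $\mathrm{rad}(B_q^m)=\sup_{z\in B_q^m}\|z\|_2$. Then, for all $x,y\in\partial B$, $$\|R_x-R_y\|_{\psi_2}\le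 C_pK^{4p}\,\mathrm{rad}(B_q^m)\,\|x-y\|_2\quad\text{and}\quad \|X_x-X_y\|_{\psi_2}\le C_pK^{4p}\,\mathrm{rad}(B_q^m)\,\|x-y\|_2 .$$ -/

import Mathlib

open MeasureTheory ProbabilityTheory
open scoped ENNReal

namespace LpDeviation

/-- The `α`-Orlicz norm `inf {t > 0 : 𝔼 exp (|X|^α / t^α) ≤ 2}`, with values in `[0, ∞]`
(the infimum of the empty set is `∞`). The expectation is a Lebesgue integral, so it is `∞`
when the exponential is not integrable. -/
noncomputable def orliczNorm {Ω : Type*} [MeasurableSpace Ω] (α : ℝ) (X : Ω → ℝ)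
    (μ : Measure Ω) : ℝ≥0∞ :=
  sInf (ENNReal.ofReal '' {t : ℝ | 0 < t ∧
    ∫⁻ ω, ENNReal.ofReal (Real.exp (|X ω| ^ α / t ^ α)) ∂μ ≤ 2})

/-- The `ℓ_r` norm on `ℝ^m`: `(∑ |z_i|^r)^(1/r)` for `0 < r < ∞`, `max |z_i|` for `r = ∞`. -/
noncomputable def ellNorm {m : ℕ} (r : ℝ≥0∞) (z : Fin m → ℝ) : ℝ :=
  ‖(WithLp.toLp r z : PiLp r (fun _ : Fin m => ℝ))‖

/-- The closed unit ball of `ℓ_r^m`, as a subset of Euclidean space. -/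
def ellBall (r : ℝ≥0∞) (m : ℕ) : Set (EuclideanSpace ℝ (Fin m)) :=
  {z | ellNorm r z.ofLp ≤ 1}

/-- `rad S = sup_{y ∈ S} ‖y‖₂`. -/
noncomputable def rad {m : ℕ} (S : Set (EuclideanSpace ℝ (Fin m))) : ℝ :=
  sSup ((fun y => ‖y‖) '' S)

section RandomMatrix

variable {Ω : Type*} [MeasurableSpace Ω] {m n : ℕ} [NeZero m] [NeZero n]

/-- `A` is an `m × n` random matrix with i.i.d. mean-zero, unit-variance,
sub-Gaussian entries. -/
structure IsIIDSubGaussianMatrix (A : Ω → Matrix (Fin m) (Fin n) ℝ) (μ : Measure Ω) : Prop where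
  measurable : ∀ i j, Measurable (fun ω => A ω i j)
  indep : iIndepFun (fun (k : Fin m × Fin n) (ω : Ω) => A ω k.1 k.2) μ
  identDistrib : ∀ i j, IdentDistrib (fun ω => A ω i j) (fun ω => A ω 0 0) μ μ
  mean_zero : ∫ ω, A ω 0 0 ∂μ = 0
  unit_variance : variance (fun ω => A ω 0 0) μ = 1
  subGaussian : orliczNorm 2 (fun ω => A ω 0 0) μ < ∞

/-- The sub-Gaussian norm `K` of the entries of `A`. -/
noncomputable def entryNorm (A : Ω → Matrix (Fin m) (Fin n) ℝ) (μ : Measure Ω) : ℝ :=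
  (orliczNorm 2 (fun ω => A ω 0 0) μ).toReal

/-- `‖x‖ = ‖A₁ x‖_{L^p} = 𝔼[|A₁ x|^p]^(1/p)`, where `A₁` is the first row of `A`. -/
noncomputable def rowNorm (p : ℝ) (A : Ω → Matrix (Fin m) (Fin n) ℝ) (μ : Measure Ω)
    (x : EuclideanSpace ℝ (Fin n)) : ℝ :=
  (∫ ω, |∑ j, A ω 0 j * x j| ^ p ∂μ) ^ (1 / p)

/-- `∂B`, the unit sphere of the norm `‖x‖ = ‖A₁ x‖_{L^p}`. -/
def rowSphere (p : ℝ) (A : Ω → Matrix (Fin m) (Fin n) ℝ) (μ : Measure Ω) :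
    Set (EuclideanSpace ℝ (Fin n)) :=
  {x | rowNorm p A μ x = 1}

/-- The process `R_x = ‖A x‖_p - m^(1/p) ‖A₁ x‖_{L^p}`. -/
noncomputable def procR (p : ℝ) (A : Ω → Matrix (Fin m) (Fin n) ℝ) (μ : Measure Ω)
    (x : EuclideanSpace ℝ (Fin n)) (ω : Ω) : ℝ :=
  ellNorm (ENNReal.ofReal p) ((A ω).mulVec x.ofLp) - (m : ℝ) ^ (1 / p) * rowNorm p A μ x

/-- The process `X_x = ‖A x‖_p - 𝔼 ‖A x‖_p`. -/
noncomputable def procX (p : ℝ) (A : Ω → Matrix (Fin m) (Fin n) ℝ) (μ : Measure Ω)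
    (x : EuclideanSpace ℝ (Fin n)) (ω : Ω) : ℝ :=
  ellNorm (ENNReal.ofReal p) ((A ω).mulVec x.ofLp)
    - ∫ ω', ellNorm (ENNReal.ofReal p) ((A ω').mulVec x.ofLp) ∂μ

end RandomMatrix

end LpDeviation

/-! On `∂B` the terms `m^(1/p) ‖x‖` and `m^(1/p) ‖y‖` agree, so `R_x - R_y = ‖Ax‖_p - ‖Ay‖_p`, while
`X_x - X_y` is the same variable centred. Everything reduces to a Gaussian tail for this difference
at scale `m^(1/p - 1/r) ‖x - y‖`, with `r = max p 2`; the power of `m` is at most `rad (B_q^m)`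
(`rpow_le_rad_ellBall`).

The tail is `exists_measure_abs_norm_sub_ge_le`, with two regimes. For a deviation parameter `s`
that is large compared with `m^(1/r)`, the triangle inequality and Hölder give `‖A(x-y)‖_p ≤ m^(1/p
- 1/r) ‖A(x-y)‖_r`, and beyond the level `m^(1/r)` the `ℓ_r` norm of a vector with independent
sub-Gaussian coordinates has a Gaussian tail. For smaller `s` the `p`-th root is linearised: outside
the event `‖Ax‖_p^p ≤ m/2`, the difference of norms is at most `2 m^(-(1 - 1/p)) |‖Ax‖_p^p -
‖Ay‖_p^p|`. Since `x` and `y` lie on the same sphere of the `L^p` norm, the right side involves a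
sum of independent centred variables, each of size about `‖x - y‖`.

The summands in both regimes are only `ψ_α` with `α = 2/r ≤ 1`. Their sums are controlled by the
truncation bound `exists_measure_sum_ge_le`, with tail `exp (-c min (t²/m, t^α))`.

The power of `K` comes from `‖x‖ ≲ K²` on `∂B`: coordinates of `Ax` have `ψ₂` norm `≲ K³`, those of
`A(x-y)` have `≲ K ‖x - y‖`, and `K · (K³)^p ≤ K^(4p)` because `K ≥ 1`. -/

namespace LpDeviation

/-! ### Sub-Gaussian tails, exponential moments of squares, and moment generating functions. -/

section Preliminaries

/-- The linear term vanishes after integrating a centred variable, leaving only the exponential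
moment of the square. -/
lemma exp_le_add_exp_sq (x : ℝ) : Real.exp x ≤ x + Real.exp (x ^ 2) := by
  have h0 := Real.add_one_le_exp (x ^ 2)
  rcases le_or_gt |x| 1 with h | h
  · have h1 := abs_le.1 (Real.abs_exp_sub_one_sub_id_le h)
    linarith [h1.2]
  · rcases lt_abs.1 h with h | h
    · have : Real.exp x ≤ Real.exp (x ^ 2) := Real.exp_le_exp.2 (by nlinarith)
      linarith
    · have : Real.exp x ≤ 1 := Real.exp_le_one_iff.2 (by linarith)
      nlinarith

lemma exists_rpow_le_mul_exp {a : ℝ} (ha : 0 ≤ a) :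
    ∃ M : ℝ, 1 ≤ M ∧ ∀ w : ℝ, 0 ≤ w → w ^ a ≤ M * Real.exp w := by
  refine ⟨max 1 ((a / 1) ^ a), le_max_left _ _, fun w hw => ?_⟩
  have h := rpow_abs_le_mul_exp_abs w ha (one_ne_zero)
  simp only [abs_of_nonneg hw, one_mul, abs_one] at h
  exact h.trans (mul_le_mul_of_nonneg_right (le_max_right _ _) (Real.exp_pos _).le)

variable {Ω : Type*} [MeasurableSpace Ω] {μ : Measure Ω}

lemma integrable_of_lintegral_ofReal_le {f : Ω → ℝ} (hf : Measurable f) (h0 : ∀ ω, 0 ≤ f ω)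
    {G : ℝ} (h : ∫⁻ ω, ENNReal.ofReal (f ω) ∂μ ≤ ENNReal.ofReal G) : Integrable f μ :=
  ⟨hf.aestronglyMeasurable, (hasFiniteIntegral_iff_ofReal (ae_of_all _ h0)).2
    (h.trans_lt ENNReal.ofReal_lt_top)⟩

lemma integral_le_of_lintegral_ofReal_le {f : Ω → ℝ} (hf : Measurable f) (h0 : ∀ ω, 0 ≤ f ω)
    {G : ℝ} (hG : 0 ≤ G) (h : ∫⁻ ω, ENNReal.ofReal (f ω) ∂μ ≤ ENNReal.ofReal G) :
    ∫ ω, f ω ∂μ ≤ G := by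
  rw [integral_eq_lintegral_of_nonneg_ae (ae_of_all _ h0) hf.aestronglyMeasurable]
  exact ENNReal.toReal_le_of_le_ofReal hG h

lemma lintegral_rpow_le [IsProbabilityMeasure μ] {f : Ω → ℝ≥0∞} (hf : Measurable f) {θ : ℝ}
    (h0 : 0 ≤ θ) (h1 : θ ≤ 1) : ∫⁻ ω, f ω ^ θ ∂μ ≤ (∫⁻ ω, f ω ∂μ) ^ θ := by
  have := ENNReal.lintegral_mul_norm_pow_le (μ := μ) (f := f) (g := fun _ => 1)
    hf.aemeasurable aemeasurable_const h0 (sub_nonneg.2 h1) (by ring)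
  simpa using this

/-- Jensen for the concave power `θ`. This is how a bound `G` on an exponential moment is traded for
the bound `2` required by the Orlicz norm. -/
lemma lintegral_exp_mul_le [IsProbabilityMeasure μ] {f : Ω → ℝ} (hf : Measurable f) {G θ : ℝ}
    (hG : 0 ≤ G) (h : ∫⁻ ω, ENNReal.ofReal (Real.exp (f ω)) ∂μ ≤ ENNReal.ofReal G)
    (h0 : 0 ≤ θ) (h1 : θ ≤ 1) :
    ∫⁻ ω, ENNReal.ofReal (Real.exp (θ * f ω)) ∂μ ≤ ENNReal.ofReal (G ^ θ) := by
  calc ∫⁻ ω, ENNReal.ofReal (Real.exp (θ * f ω)) ∂μ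
      = ∫⁻ ω, ENNReal.ofReal (Real.exp (f ω)) ^ θ ∂μ := by
        refine lintegral_congr fun ω => ?_
        rw [ENNReal.ofReal_rpow_of_nonneg (Real.exp_pos _).le h0, ← Real.exp_mul, mul_comm]
    _ ≤ (∫⁻ ω, ENNReal.ofReal (Real.exp (f ω)) ∂μ) ^ θ :=
        lintegral_rpow_le (by fun_prop) h0 h1
    _ ≤ ENNReal.ofReal G ^ θ := ENNReal.rpow_le_rpow h h0
    _ = ENNReal.ofReal (G ^ θ) := ENNReal.ofReal_rpow_of_nonneg hG h0

/-- A Gaussian tail bound gives a bound on the exponential moment of the square. -/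
lemma lintegral_exp_sq_le_of_tail [IsProbabilityMeasure μ] {Z : Ω → ℝ} (hZ : Measurable Z)
    {b C : ℝ} (hb : 0 < b) (hC : 1 ≤ C)
    (h : ∀ s : ℝ, 0 ≤ s → μ {ω | b * s ≤ |Z ω|} ≤ ENNReal.ofReal (C * Real.exp (-s ^ 2))) :
    ∫⁻ ω, ENNReal.ofReal (Real.exp (Z ω ^ 2 / (2 * C * b ^ 2))) ∂μ ≤ 2 := by
  -- Layer cake: the tail at level `t > 1` is at most `C t^(-2)`, which integrates to `C`; levels in
  -- `(0, 1]` contribute at most `1`.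
  have key : ∫⁻ ω, ENNReal.ofReal (Real.exp (Z ω ^ 2 / (2 * b ^ 2))) ∂μ
      ≤ ENNReal.ofReal (1 + C) := by
    rw [lintegral_eq_lintegral_meas_le μ (ae_of_all _ fun ω => (Real.exp_pos _).le)
      (by fun_prop)]
    have hsplit : Set.Ioi (0 : ℝ) = Set.Ioc 0 1 ∪ Set.Ioi 1 :=
      (Set.Ioc_union_Ioi_eq_Ioi zero_le_one).symm
    rw [hsplit]
    refine (lintegral_union_le _ _ _).trans ?_
    rw [ENNReal.ofReal_add zero_le_one (by linarith)]
    refine add_le_add ?_ ?_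
    · calc _ ≤ ∫⁻ _ in Set.Ioc (0 : ℝ) 1, 1 := lintegral_mono fun t => prob_le_one
        _ = _ := by simp
    · calc _ ≤ ∫⁻ t in Set.Ioi (1 : ℝ), ENNReal.ofReal (C * t ^ (-2 : ℝ)) := by
            refine setLIntegral_mono' measurableSet_Ioi fun t ht => ?_
            have ht' : (1 : ℝ) < t := ht
            have ht0 : 0 < t := by linarith
            have hl : 0 ≤ Real.log t := Real.log_nonneg ht'.le
            refine (measure_mono fun ω hω => ?_).trans ((h (Real.sqrt (2 * Real.log t))
              (Real.sqrt_nonneg _)).trans (le_of_eq ?_))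
            · simp only [Set.mem_ofPred_eq] at hω ⊢
              have h2 := (Real.log_le_iff_le_exp ht0).2 hω
              rw [le_div_iff₀ (by positivity)] at h2
              refine Real.le_sqrt_of_sq_le ?_ |>.trans_eq (Real.sqrt_sq_eq_abs _)
              rw [mul_pow, Real.sq_sqrt (by positivity)]
              linarith
            · rw [Real.sq_sqrt (by positivity), Real.rpow_def_of_pos ht0]
              ring_nf
        _ = ENNReal.ofReal (∫ t in Set.Ioi (1 : ℝ), C * t ^ (-2 : ℝ)) := by
            rw [ofReal_integral_eq_lintegral_ofReal]
            · exact (integrableOn_Ioi_rpow_of_lt (by norm_num) zero_lt_one).const_mul C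
            · refine (ae_restrict_iff' measurableSet_Ioi).2 (ae_of_all _ fun t ht => ?_)
              have ht' : (1 : ℝ) < t := ht
              have : 0 < t := by linarith
              show 0 ≤ C * t ^ (-2 : ℝ)
              positivity
        _ = ENNReal.ofReal C := by
            rw [integral_const_mul, integral_Ioi_rpow_of_lt (by norm_num) zero_lt_one]
            norm_num
  -- The exponent `1 / C` brings `1 + C` down to `2`, since `1 + C ≤ 2 ^ C` by Bernoulli.
  have h2 := lintegral_exp_mul_le (θ := 1 / C) (by fun_prop) (by linarith) key (by positivity)
    ((div_le_one (by linarith)).2 hC)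
  refine le_trans (le_of_eq ?_) (h2.trans ?_)
  · refine lintegral_congr fun ω => ?_
    congr 2
    field_simp
  · rw [show (2 : ℝ≥0∞) = ENNReal.ofReal 2 by simp]
    refine ENNReal.ofReal_le_ofReal ?_
    have h3 := one_add_mul_self_le_rpow_one_add (s := 1) (by norm_num) hC
    calc (1 + C) ^ (1 / C) ≤ ((2 : ℝ) ^ C) ^ (1 / C) := by
          refine Real.rpow_le_rpow (by linarith) ?_ (by positivity)
          norm_num at h3
          exact h3
      _ = 2 := by
          rw [← Real.rpow_mul (by norm_num), mul_one_div_cancel (by linarith), Real.rpow_one]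

/-- A centred variable with finite `ψ₂` norm has a sub-Gaussian moment generating function. -/
lemma hasSubgaussianMGF_of_lintegral_exp_sq_le [IsProbabilityMeasure μ] {Z : Ω → ℝ}
    (hZ : Measurable Z) {t : ℝ} (ht : 0 < t)
    (h : ∫⁻ ω, ENNReal.ofReal (Real.exp (Z ω ^ 2 / t ^ 2)) ∂μ ≤ 2) (h0 : ∫ ω, Z ω ∂μ = 0) :
    HasSubgaussianMGF Z (Real.toNNReal (2 * t ^ 2)) μ := by
  have h' : ∫⁻ ω, ENNReal.ofReal (Real.exp (Z ω ^ 2 / t ^ 2)) ∂μ ≤ ENNReal.ofReal 2 := by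
    simpa using h
  have hI : Integrable (fun ω => Real.exp (Z ω ^ 2 / t ^ 2)) μ :=
    integrable_of_lintegral_ofReal_le (by fun_prop) (fun ω => (Real.exp_pos _).le) h'
  have hmom : ∀ θ : ℝ, 0 ≤ θ → θ ≤ 1 →
      Integrable (fun ω => Real.exp (θ * (Z ω ^ 2 / t ^ 2))) μ ∧
      ∫ ω, Real.exp (θ * (Z ω ^ 2 / t ^ 2)) ∂μ ≤ 2 ^ θ := by
    intro θ hθ0 hθ1
    have := lintegral_exp_mul_le (f := fun ω => Z ω ^ 2 / t ^ 2) (by fun_prop) (by norm_num) h'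
      hθ0 hθ1
    exact ⟨integrable_of_lintegral_ofReal_le (by fun_prop) (fun ω => (Real.exp_pos _).le) this,
      integral_le_of_lintegral_ofReal_le (by fun_prop) (fun ω => (Real.exp_pos _).le)
        (by positivity) this⟩
  have hbound : ∀ l : ℝ, ∀ ω, Real.exp (l * Z ω)
      ≤ Real.exp (l ^ 2 * t ^ 2 / 2) * Real.exp (1 / 2 * (Z ω ^ 2 / t ^ 2)) := by
    intro l ω
    rw [← Real.exp_add]
    refine Real.exp_le_exp.2 ?_
    have : 0 ≤ (l * t - Z ω / t) ^ 2 := sq_nonneg _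
    have e : (l * t - Z ω / t) ^ 2 = l ^ 2 * t ^ 2 - 2 * (l * Z ω) + Z ω ^ 2 / t ^ 2 := by
      field_simp
      ring
    linarith
  have hint : ∀ l : ℝ, Integrable (fun ω => Real.exp (l * Z ω)) μ := fun l =>
    ((hmom (1 / 2) (by norm_num) (by norm_num)).1.const_mul (Real.exp (l ^ 2 * t ^ 2 / 2))).mono'
      (by fun_prop) (ae_of_all _ fun ω => by
        rw [Real.norm_eq_abs, abs_of_pos (Real.exp_pos _)]; exact hbound l ω)
  have hZi : Integrable Z μ := by
    refine (hI.const_mul t).mono' (by fun_prop) (ae_of_all _ fun ω => ?_)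
    have h1 := Real.add_one_le_exp (Z ω ^ 2 / t ^ 2)
    have h2 : |Z ω| ≤ t * (Z ω ^ 2 / t ^ 2 + 1) := by
      have : 0 ≤ (|Z ω| - t) ^ 2 := sq_nonneg _
      have hz : 0 ≤ |Z ω| := abs_nonneg _
      have e : t * (Z ω ^ 2 / t ^ 2 + 1) = (|Z ω| ^ 2 + t ^ 2) / t := by
        rw [sq_abs]; field_simp
      rw [e, le_div_iff₀ ht]
      nlinarith
    exact h2.trans (mul_le_mul_of_nonneg_left h1 ht.le)
  refine ⟨hint, fun l => ?_⟩
  rw [Real.coe_toNNReal _ (by positivity), mgf]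
  have hexp2 : (2 : ℝ) ≤ Real.exp 1 := by linarith [Real.add_one_le_exp (1 : ℝ)]
  -- For small `l`, centring removes the linear term and Jensen applies with exponent `l² t² ≤ 1`.
  -- For large `l`, the AM-GM bound `hbound` suffices: its extra factor `exp (1/2)` is absorbed
  -- because `l² t² > 1`.
  rcases le_or_gt (l ^ 2 * t ^ 2) 1 with hl | hl
  · obtain ⟨i1, i2⟩ := hmom (l ^ 2 * t ^ 2) (by positivity) hl
    calc ∫ ω, Real.exp (l * Z ω) ∂μ
        ≤ ∫ ω, (l * Z ω + Real.exp (l ^ 2 * t ^ 2 * (Z ω ^ 2 / t ^ 2))) ∂μ := by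
          refine integral_mono (hint l) ((hZi.const_mul l).add i1) fun ω => ?_
          have := exp_le_add_exp_sq (l * Z ω)
          have e : l ^ 2 * t ^ 2 * (Z ω ^ 2 / t ^ 2) = (l * Z ω) ^ 2 := by field_simp
          simp only [e]; exact this
      _ = ∫ ω, Real.exp (l ^ 2 * t ^ 2 * (Z ω ^ 2 / t ^ 2)) ∂μ := by
          rw [integral_add (hZi.const_mul l) i1, integral_const_mul, h0]; simp
      _ ≤ 2 ^ (l ^ 2 * t ^ 2) := i2
      _ ≤ Real.exp 1 ^ (l ^ 2 * t ^ 2) := by gcongr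
      _ = _ := by rw [← Real.exp_mul]; congr 1; ring
  · obtain ⟨i1, i2⟩ := hmom (1 / 2) (by norm_num) (by norm_num)
    calc ∫ ω, Real.exp (l * Z ω) ∂μ
        ≤ ∫ ω, Real.exp (l ^ 2 * t ^ 2 / 2) * Real.exp (1 / 2 * (Z ω ^ 2 / t ^ 2)) ∂μ :=
          integral_mono (hint l) (i1.const_mul _) (hbound l)
      _ = Real.exp (l ^ 2 * t ^ 2 / 2) * ∫ ω, Real.exp (1 / 2 * (Z ω ^ 2 / t ^ 2)) ∂μ :=
          integral_const_mul _ _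
      _ ≤ Real.exp (l ^ 2 * t ^ 2 / 2) * Real.exp 1 ^ (1 / 2 : ℝ) := by
          gcongr; exact i2.trans (by gcongr)
      _ ≤ _ := by
          rw [← Real.exp_mul, ← Real.exp_add]
          refine Real.exp_le_exp.2 ?_
          linarith

/-- A sub-Gaussian moment generating function gives a bound on the `ψ₂` norm. -/
lemma lintegral_exp_sq_le_of_hasSubgaussianMGF [IsProbabilityMeasure μ] {Z : Ω → ℝ}
    (hZ : Measurable Z) {b : ℝ} (hb : 0 < b)
    (h : HasSubgaussianMGF Z (Real.toNNReal (b ^ 2)) μ) :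
    ∫⁻ ω, ENNReal.ofReal (Real.exp (Z ω ^ 2 / (8 * b ^ 2))) ∂μ ≤ 2 := by
  have key := lintegral_exp_sq_le_of_tail (μ := μ) hZ (b := Real.sqrt 2 * b) (C := 2)
    (by positivity) (by norm_num) fun s hs => by
      have hsub : {ω | Real.sqrt 2 * b * s ≤ |Z ω|}
          ⊆ {ω | Real.sqrt 2 * b * s ≤ Z ω} ∪ {ω | Real.sqrt 2 * b * s ≤ (-Z) ω} := by
        intro ω hω
        simp only [Set.mem_union, Set.mem_ofPred_eq, Pi.neg_apply] at hω ⊢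
        exact le_abs.1 hω
      have hs' : 0 ≤ Real.sqrt 2 * b * s := by positivity
      have e : -(Real.sqrt 2 * b * s) ^ 2 / (2 * (Real.toNNReal (b ^ 2) : ℝ)) = -s ^ 2 := by
        rw [Real.coe_toNNReal _ (by positivity), mul_pow, mul_pow, Real.sq_sqrt (by norm_num)]
        field_simp
      have h1 := h.measure_ge_le hs'
      have h2 := h.neg.measure_ge_le hs'
      rw [e] at h1 h2
      rw [two_mul, ENNReal.ofReal_add (Real.exp_pos _).le (Real.exp_pos _).le]
      refine (measure_mono hsub).trans ((measure_union_le _ _).trans (add_le_add ?_ ?_))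
      · exact (ENNReal.le_ofReal_iff_toReal_le (measure_ne_top _ _) (Real.exp_pos _).le).2 h1
      · exact (ENNReal.le_ofReal_iff_toReal_le (measure_ne_top _ _) (Real.exp_pos _).le).2 h2
  convert key using 6
  rw [mul_pow, Real.sq_sqrt (by norm_num)]; ring

end Preliminaries

/-! ### Sums of independent `ψ_α` variables, `0 < α ≤ 1`, by truncation. -/

section HeavyTail

/-- The exponential factor sees only the positive part of `x`, which is why truncation from above is
enough. -/
lemma exp_le_one_add_add_sq_mul_exp (x : ℝ) :
    Real.exp x ≤ 1 + x + x ^ 2 * Real.exp (max x 0) := by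
  have h1 : 1 ≤ Real.exp (max x 0) := Real.one_le_exp (le_max_right _ _)
  have h2 : x ^ 2 ≤ x ^ 2 * Real.exp (max x 0) := le_mul_of_one_le_right (sq_nonneg x) h1
  rcases le_or_gt |x| 1 with h | h
  · have := (abs_le.1 (Real.abs_exp_sub_one_sub_id_le h)).2
    linarith
  · rcases lt_abs.1 h with h | h
    · rw [max_eq_left (by linarith)]
      have : Real.exp x ≤ x ^ 2 * Real.exp x :=
        le_mul_of_one_le_left (Real.exp_pos _).le (by nlinarith)
      linarith
    · have : Real.exp x ≤ 1 := Real.exp_le_one_iff.2 (by linarith)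
      nlinarith

lemma exists_sq_le_mul_exp_half {α : ℝ} (hα : 0 < α) :
    ∃ M : ℝ, 1 ≤ M ∧ ∀ z : ℝ, 0 ≤ z → z ^ 2 ≤ M * Real.exp (z ^ α / 2) := by
  obtain ⟨M, hM, h⟩ := exists_rpow_le_mul_exp (a := 2 / α) (by positivity)
  refine ⟨2 ^ (2 / α) * M, ?_, fun z hz => ?_⟩
  · exact one_le_mul_of_one_le_of_one_le (Real.one_le_rpow (by norm_num) (by positivity)) hM
  · have h1 := h (z ^ α / 2) (by positivity)
    rw [Real.div_rpow (by positivity) (by norm_num), ← Real.rpow_mul hz,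
      mul_div_cancel₀ _ hα.ne', Real.rpow_two, div_le_iff₀ (by positivity)] at h1
    linarith

/-- Truncation from above. -/
noncomputable def truncAbove (t z : ℝ) : ℝ := if z ≤ t then z else 0

lemma measurable_truncAbove (t : ℝ) : Measurable (truncAbove t) :=
  Measurable.ite measurableSet_Iic measurable_id measurable_const

/-- For `0 < z ≤ t`, `l z = (l z^(1-α)) z^α ≤ z^α / 2`, so half of the available exponential moment
pays for `exp (l z)` and the other half for `z²`. The linear term keeps the untruncated `z`, so the
mean hypothesis on the original variable can be used directly. -/
lemma exp_mul_truncAbove_le {α M t l : ℝ} (hα : α ≤ 1) (ht : 0 < t) (hl : 0 ≤ l)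
    (hlt : l * t ^ (1 - α) ≤ 1 / 2)
    (hM : ∀ z : ℝ, 0 ≤ z → z ^ 2 ≤ M * Real.exp (z ^ α / 2)) (z : ℝ) :
    Real.exp (l * truncAbove t z) ≤ 1 + l * z + l ^ 2 * (M * Real.exp (|z| ^ α)) := by
  have hM0 : 0 ≤ M := by
    have h := (hM 0 le_rfl).trans' (sq_nonneg _)
    exact nonneg_of_mul_nonneg_left h (Real.exp_pos _)
  have hle : truncAbove t z ≤ z := by
    unfold truncAbove; split_ifs with h <;> linarith
  have hsq : truncAbove t z ^ 2 ≤ z ^ 2 := by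
    unfold truncAbove; split_ifs with h
    · rfl
    · rw [zero_pow two_ne_zero]; positivity
  have hmax : max (l * truncAbove t z) 0 ≤ |z| ^ α / 2 := by
    refine max_le ?_ (by positivity)
    unfold truncAbove; split_ifs with h
    · rcases le_or_gt z 0 with hz | hz
      · exact (mul_nonpos_of_nonneg_of_nonpos hl hz).trans (by positivity)
      · rw [abs_of_pos hz]
        have e : z = z ^ (1 - α) * z ^ α := by
          rw [← Real.rpow_add hz]; simp
        calc l * z = l * z ^ (1 - α) * z ^ α := by rw [mul_assoc, ← e]
          _ ≤ l * t ^ (1 - α) * z ^ α := by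
              gcongr
          _ ≤ 1 / 2 * z ^ α := by gcongr
          _ = _ := by ring
    · rw [mul_zero]; positivity
  refine (exp_le_one_add_add_sq_mul_exp _).trans ?_
  have h1 : l * truncAbove t z ≤ l * z := mul_le_mul_of_nonneg_left hle hl
  have h2 : (l * truncAbove t z) ^ 2 * Real.exp (max (l * truncAbove t z) 0)
      ≤ l ^ 2 * (M * Real.exp (|z| ^ α)) := by
    rw [mul_pow, mul_assoc]
    refine mul_le_mul_of_nonneg_left ?_ (sq_nonneg l)
    calc truncAbove t z ^ 2 * Real.exp (max (l * truncAbove t z) 0)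
        ≤ |z| ^ 2 * Real.exp (|z| ^ α / 2) := by
          rw [sq_abs]; gcongr
      _ ≤ M * Real.exp (|z| ^ α / 2) * Real.exp (|z| ^ α / 2) := by
          gcongr; exact hM _ (abs_nonneg z)
      _ = _ := by rw [mul_assoc, ← Real.exp_add, add_halves]
  linarith

variable {Ω : Type*} [MeasurableSpace Ω] {μ : Measure Ω}

lemma mgf_truncAbove_le [IsProbabilityMeasure μ] {Y : Ω → ℝ} (hY : Measurable Y)
    {α M G t l : ℝ} (hα : α ≤ 1) (hG : 0 ≤ G) (ht : 0 < t) (hl : 0 ≤ l)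
    (hlt : l * t ^ (1 - α) ≤ 1 / 2) (hM1 : 1 ≤ M)
    (hM : ∀ z : ℝ, 0 ≤ z → z ^ 2 ≤ M * Real.exp (z ^ α / 2))
    (h : ∫⁻ ω, ENNReal.ofReal (Real.exp (|Y ω| ^ α)) ∂μ ≤ ENNReal.ofReal G)
    (h0 : ∫ ω, Y ω ∂μ ≤ 0) :
    Integrable (fun ω => Real.exp (l * truncAbove t (Y ω))) μ ∧
      mgf (fun ω => truncAbove t (Y ω)) μ l ≤ Real.exp (l ^ 2 * (M * G)) := by
  have hmeas : Measurable fun ω => Real.exp (|Y ω| ^ α) := by fun_prop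
  have hI : Integrable (fun ω => Real.exp (|Y ω| ^ α)) μ :=
    integrable_of_lintegral_ofReal_le hmeas (fun ω => (Real.exp_pos _).le) h
  have hE : ∫ ω, Real.exp (|Y ω| ^ α) ∂μ ≤ G :=
    integral_le_of_lintegral_ofReal_le hmeas (fun ω => (Real.exp_pos _).le) hG h
  have hYi : Integrable Y μ := by
    refine ((integrable_const (1 : ℝ)).add (hI.const_mul M)).mono' hY.aestronglyMeasurable (ae_of_all _ fun ω => ?_)
    have h1 := hM _ (abs_nonneg (Y ω))
    have h2 : M * Real.exp (|Y ω| ^ α / 2) ≤ M * Real.exp (|Y ω| ^ α) := by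
      gcongr
      exact half_le_self (by positivity)
    rw [Real.norm_eq_abs]
    show |Y ω| ≤ 1 + M * Real.exp (|Y ω| ^ α)
    nlinarith [sq_nonneg (|Y ω| - 1), abs_nonneg (Y ω)]
  have hYl : Integrable (fun ω => 1 + l * Y ω) μ := (integrable_const (1 : ℝ)).add (hYi.const_mul l)
  have hR : Integrable (fun ω => 1 + l * Y ω + l ^ 2 * (M * Real.exp (|Y ω| ^ α))) μ :=
    hYl.add ((hI.const_mul M).const_mul (l ^ 2))
  have hb := fun ω => exp_mul_truncAbove_le hα ht hl hlt hM (Y ω)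
  have hint : Integrable (fun ω => Real.exp (l * truncAbove t (Y ω))) μ := by
    refine hR.mono' ?_ (ae_of_all _ fun ω => ?_)
    · exact (Real.measurable_exp.comp (((measurable_truncAbove t).comp hY).const_mul l)).aestronglyMeasurable
    · rw [Real.norm_eq_abs, abs_of_pos (Real.exp_pos _)]; exact hb ω
  refine ⟨hint, ?_⟩
  calc mgf (fun ω => truncAbove t (Y ω)) μ l
      ≤ ∫ ω, (1 + l * Y ω + l ^ 2 * (M * Real.exp (|Y ω| ^ α))) ∂μ := integral_mono hint hR hb
    _ = 1 + l * ∫ ω, Y ω ∂μ + l ^ 2 * (M * ∫ ω, Real.exp (|Y ω| ^ α) ∂μ) := by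
        rw [integral_add hYl ((hI.const_mul M).const_mul (l ^ 2)),
          integral_add (integrable_const _) (hYi.const_mul l)]
        simp only [integral_const_mul, integral_const, probReal_univ, smul_eq_mul, mul_one]
    _ ≤ 1 + 0 + l ^ 2 * (M * G) := by
        gcongr
        exact mul_nonpos_of_nonneg_of_nonpos hl h0
    _ ≤ Real.exp (l ^ 2 * (M * G)) := by
        linarith [Real.add_one_le_exp (l ^ 2 * (M * G))]

lemma measure_lt_le_exp_neg_rpow {Y : Ω → ℝ} (hY : Measurable Y) {α G t : ℝ} (hα : 0 < α)
    (ht : 0 ≤ t) (h : ∫⁻ ω, ENNReal.ofReal (Real.exp (|Y ω| ^ α)) ∂μ ≤ ENNReal.ofReal G) :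
    μ {ω | t < Y ω} ≤ ENNReal.ofReal (G * Real.exp (-t ^ α)) := by
  have h1 := mul_meas_ge_le_lintegral₀ (μ := μ)
    (f := fun ω => ENNReal.ofReal (Real.exp (|Y ω| ^ α))) (by fun_prop)
    (ENNReal.ofReal (Real.exp (t ^ α)))
  have h2 : μ {ω | t < Y ω}
      ≤ μ {ω | ENNReal.ofReal (Real.exp (t ^ α)) ≤ ENNReal.ofReal (Real.exp (|Y ω| ^ α))} := by
    refine measure_mono fun ω hω => ?_
    simp only [Set.mem_ofPred_eq] at hω ⊢
    refine ENNReal.ofReal_le_ofReal (Real.exp_le_exp.2 (Real.rpow_le_rpow ht ?_ hα.le))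
    exact hω.le.trans (le_abs_self _)
  have hpos : ENNReal.ofReal (Real.exp (t ^ α)) ≠ 0 := by
    simpa using Real.exp_pos _
  rw [Real.exp_neg, ← div_eq_mul_inv, ENNReal.ofReal_div_of_pos (Real.exp_pos _),
    ENNReal.le_div_iff_mul_le (Or.inl hpos) (Or.inl ENNReal.ofReal_ne_top), mul_comm]
  exact (mul_le_mul_right h2 _).trans (h1.trans h)

/-- Upper tail of a sum of independent variables with non-positive means and bounded
`ψ_α` norms, `0 < α ≤ 1`. -/
theorem exists_measure_sum_ge_le {α G : ℝ} (hα0 : 0 < α) (hα1 : α ≤ 1) (hG : 1 ≤ G) :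
    ∃ C c : ℝ, 1 ≤ C ∧ 0 < c ∧ ∀ {Ω : Type*} [MeasurableSpace Ω] (μ : Measure Ω)
      [IsProbabilityMeasure μ] (m : ℕ) (Y : Fin m → Ω → ℝ), 0 < m →
      (∀ i, Measurable (Y i)) → iIndepFun Y μ →
      (∀ i, ∫⁻ ω, ENNReal.ofReal (Real.exp (|Y i ω| ^ α)) ∂μ ≤ ENNReal.ofReal G) →
      (∀ i, ∫ ω, Y i ω ∂μ ≤ 0) → ∀ t : ℝ, 0 ≤ t →
      μ {ω | t ≤ ∑ i, Y i ω}
        ≤ ENNReal.ofReal (C * Real.exp (-(c * min (t ^ 2 / m) (t ^ α)))) := by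
  obtain ⟨M, hM1, hM⟩ := exists_sq_le_mul_exp_half hα0
  have hMG : 1 ≤ M * G := one_le_mul_of_one_le_of_one_le hM1 hG
  refine ⟨2 * (1 + M * G), 1 / (4 * (M * G)), by linarith, by positivity, ?_⟩
  intro Ω _ μ _ m Y hm hYm hind hexp hmean t ht0
  have hm0 : (0 : ℝ) < m := Nat.cast_pos.2 hm
  have hc4 : 1 / (4 * (M * G)) ≤ 1 / 4 := by
    rw [div_le_div_iff₀ (by positivity) (by norm_num)]; linarith
  have hc0 : 0 < 1 / (4 * (M * G)) := by positivity
  have hmin0 : 0 ≤ min (t ^ 2 / m) (t ^ α) := le_min (by positivity) (by positivity)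
  -- If `t² < m` the exponent is at most `1/4` in absolute value and the claimed bound exceeds `1`.
  rcases lt_or_ge (t ^ 2) m with htm | htm
  · refine prob_le_one.trans ?_
    rw [show (1 : ℝ≥0∞) = ENNReal.ofReal 1 by simp]
    refine ENNReal.ofReal_le_ofReal ?_
    have h1 : min (t ^ 2 / m) (t ^ α) ≤ 1 :=
      (min_le_left _ _).trans ((div_le_one hm0).2 htm.le)
    have h2 : 1 / (4 * (M * G)) * min (t ^ 2 / m) (t ^ α) ≤ 1 / 4 * 1 :=
      mul_le_mul hc4 h1 hmin0 (by norm_num)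
    have h3 := Real.add_one_le_exp (-(1 / (4 * (M * G)) * min (t ^ 2 / m) (t ^ α)))
    nlinarith
  · have ht : 0 < t := by
      rcases ht0.eq_or_lt with h | h
      · rw [← h] at htm; norm_num at htm; omega
      · exact h
    -- The first entry keeps the quadratic cost `m l² M G` below half the gain `l t`; the second is
    -- the largest `l` allowed by the truncated moment generating function bound.
    set l := min (t / (2 * m * (M * G))) (t ^ (α - 1) / 2) with hl
    have hl0 : 0 ≤ l := le_min (by positivity) (by positivity)
    have hl1 : l * t ^ (1 - α) ≤ 1 / 2 := by
      calc l * t ^ (1 - α) ≤ t ^ (α - 1) / 2 * t ^ (1 - α) := by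
            gcongr; exact min_le_right _ _
        _ = (t ^ (α - 1) * t ^ (1 - α)) / 2 := by ring
        _ = 1 / 2 := by rw [← Real.rpow_add ht]; simp
    have hl2 : (m : ℝ) * (l ^ 2 * (M * G)) ≤ l * t / 2 := by
      have h1 : l * (2 * m * (M * G)) ≤ t := by
        rw [← le_div_iff₀ (by positivity)]; exact min_le_left _ _
      nlinarith
    have hlt : 1 / (4 * (M * G)) * min (t ^ 2 / m) (t ^ α) ≤ l * t / 2 := by
      have e : l * t / 2 = min (1 / (4 * (M * G)) * (t ^ 2 / m)) (1 / 4 * t ^ α) := by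
        rw [hl, min_mul_of_nonneg _ _ ht.le, ← min_div_div_right (by norm_num)]
        congr 1
        · field_simp
          norm_num
        · rw [show t ^ (α - 1) / 2 * t = t ^ (α - 1) * t ^ (1 : ℝ) / 2 by
            rw [Real.rpow_one]; ring, ← Real.rpow_add ht]
          simp; ring
      rw [e]
      refine le_min ?_ ?_
      · gcongr; exact min_le_left _ _
      · gcongr; exact min_le_right _ _
    have hmt : (m : ℝ) ≤ M * Real.exp (t ^ α / 2) := htm.trans (hM t ht.le)
    have hind' : iIndepFun (fun i ω => truncAbove t (Y i ω)) μ :=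
      hind.comp (fun _ => truncAbove t) (fun _ => measurable_truncAbove t)
    have hm' : ∀ i, Measurable fun ω => truncAbove t (Y i ω) := fun i =>
      (measurable_truncAbove t).comp (hYm i)
    have hmgf := fun i => mgf_truncAbove_le (hYm i) hα1 (by linarith) ht hl0 hl1 hM1 hM
      (hexp i) (hmean i)
    have htrunc : μ {ω | t ≤ ∑ i, truncAbove t (Y i ω)}
        ≤ ENNReal.ofReal (Real.exp (-(l * t / 2))) := by
      rw [ENNReal.le_ofReal_iff_toReal_le (measure_ne_top _ _) (Real.exp_pos _).le]
      have h1 := measure_ge_le_exp_mul_mgf (μ := μ)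
        (X := ∑ i, fun ω => truncAbove t (Y i ω)) t hl0
        (hind'.integrable_exp_mul_sum hm' fun i _ => (hmgf i).1)
      rw [hind'.mgf_sum hm'] at h1
      simp only [Finset.sum_apply] at h1
      refine h1.trans ?_
      calc Real.exp (-l * t) * ∏ i, mgf (fun ω => truncAbove t (Y i ω)) μ l
          ≤ Real.exp (-l * t) * ∏ _i : Fin m, Real.exp (l ^ 2 * (M * G)) := by
            gcongr with i _
            · exact fun i _ => mgf_nonneg
            · exact (hmgf i).2
        _ = Real.exp (-l * t + m * (l ^ 2 * (M * G))) := by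
            simp [Real.exp_add, Real.exp_nat_mul]
        _ ≤ _ := Real.exp_le_exp.2 (by linarith)
    have hsub : {ω | t ≤ ∑ i, Y i ω}
        ⊆ {ω | t ≤ ∑ i, truncAbove t (Y i ω)} ∪ ⋃ i, {ω | t < Y i ω} := by
      intro ω hω
      by_cases hex : ∃ i, t < Y i ω
      · exact Or.inr (Set.mem_iUnion.2 hex)
      · push Not at hex
        left
        simp only [Set.mem_ofPred_eq, truncAbove, hex, if_true] at hω ⊢
        exact hω
    -- The factor `m` of the union bound is absorbed by half the exponent, since `m ≤ t² ≤ M exp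
    -- (t^α / 2)`.
    have hunion : μ (⋃ i, {ω | t < Y i ω})
        ≤ ENNReal.ofReal (M * G * Real.exp (-(t ^ α / 2))) := by
      calc μ (⋃ i, {ω | t < Y i ω}) ≤ ∑ i, μ {ω | t < Y i ω} := measure_iUnion_fintype_le _ _
        _ ≤ ∑ _i : Fin m, ENNReal.ofReal (G * Real.exp (-t ^ α)) :=
            Finset.sum_le_sum fun i _ => measure_lt_le_exp_neg_rpow (hYm i) hα0 ht0 (hexp i)
        _ = ENNReal.ofReal (m * (G * Real.exp (-t ^ α))) := by
            simp [ENNReal.ofReal_mul]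
        _ ≤ _ := by
            refine ENNReal.ofReal_le_ofReal ?_
            calc (m : ℝ) * (G * Real.exp (-t ^ α))
                ≤ M * Real.exp (t ^ α / 2) * (G * Real.exp (-t ^ α)) := by gcongr
              _ = M * G * (Real.exp (t ^ α / 2) * Real.exp (-t ^ α)) := by ring
              _ = _ := by rw [← Real.exp_add]; congr 2; ring
    refine (measure_mono hsub).trans ((measure_union_le _ _).trans
      ((add_le_add htrunc hunion).trans ?_))
    rw [← ENNReal.ofReal_add (Real.exp_pos _).le (by positivity)]
    refine ENNReal.ofReal_le_ofReal ?_
    set E := Real.exp (-(1 / (4 * (M * G)) * min (t ^ 2 / m) (t ^ α))) with hE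
    have hE0 : 0 < E := Real.exp_pos _
    have h1 : Real.exp (-(l * t / 2)) ≤ E := Real.exp_le_exp.2 (by linarith)
    have h2 : Real.exp (-(t ^ α / 2)) ≤ E := by
      refine Real.exp_le_exp.2 (neg_le_neg ?_)
      calc 1 / (4 * (M * G)) * min (t ^ 2 / m) (t ^ α) ≤ 1 / 4 * t ^ α :=
            mul_le_mul hc4 (min_le_right _ _) hmin0 (by norm_num)
        _ ≤ t ^ α / 2 := by
            have : 0 ≤ t ^ α := by positivity
            linarith
    nlinarith [mul_le_mul_of_nonneg_left h2 (by positivity : 0 ≤ M * G)]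

end HeavyTail

/-! ### Rows of `A` applied to a vector: independence, sub-Gaussian bounds, and the size of `∂B`. -/

section LinearForms

section RowForm

variable {Ω : Type*} {m n : ℕ}

/-- The `i`-th coordinate of `A x`. -/
noncomputable def rowForm (A : Ω → Matrix (Fin m) (Fin n) ℝ) (x : EuclideanSpace ℝ (Fin n))
    (i : Fin m) (ω : Ω) : ℝ := ∑ j, A ω i j * x j

lemma rowForm_sub (A : Ω → Matrix (Fin m) (Fin n) ℝ) (x y : EuclideanSpace ℝ (Fin n))
    (i : Fin m) (ω : Ω) : rowForm A (x - y) i ω = rowForm A x i ω - rowForm A y i ω := by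
  simp [rowForm, mul_sub, Finset.sum_sub_distrib]

end RowForm

variable {Ω : Type*} [MeasurableSpace Ω] {μ : Measure Ω}

/-- Independent entries regroup into independent rows: the joint law is a product measure, and
currying turns it into a product of products. -/
lemma iIndepFun_curry {ι κ X : Type*} [Countable ι] [Countable κ] [MeasurableSpace X]
    [IsProbabilityMeasure μ] {Y : ι → κ → Ω → X} (hY : ∀ i j, Measurable (Y i j))
    (h : iIndepFun (fun (k : ι × κ) ω => Y k.1 k.2 ω) μ) :
    iIndepFun (fun i ω j => Y i j ω) μ := by
  have hp : ∀ i j, IsProbabilityMeasure (μ.map (Y i j)) := fun i j =>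
    Measure.isProbabilityMeasure_map (hY i j).aemeasurable
  have hrow : ∀ i, iIndepFun (Y i) μ := fun i =>
    h.precomp (g := fun j => (i, j)) fun a b hab => (Prod.mk.inj hab).2
  rw [iIndepFun_iff_map_fun_eq_infinitePi_map (fun i => measurable_pi_lambda _ (hY i))]
  have h1 := (iIndepFun_iff_map_fun_eq_infinitePi_map (fun k : ι × κ => hY k.1 k.2)).1 h
  have h2 : ∀ i, μ.map (fun ω j => Y i j ω) = Measure.infinitePi fun j => μ.map (Y i j) :=
    fun i => (iIndepFun_iff_map_fun_eq_infinitePi_map (hY i)).1 (hrow i)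
  simp_rw [h2]
  rw [← Measure.infinitePi_map_curry (fun i j => μ.map (Y i j)), ← h1]
  exact (Measure.map_map (MeasurableEquiv.curry ι κ X).measurable
    (measurable_pi_lambda _ fun k : ι × κ => hY k.1 k.2)).symm

/-- From `1 + u ≤ exp u`, unit second moment gives `1 + 1/t² ≤ 2`. This later allows powers of `t`
to be raised to the common exponent `4p`. -/
lemma one_le_of_lintegral_exp_sq_le [IsProbabilityMeasure μ] {Z : Ω → ℝ} (hZ : Measurable Z)
    {t : ℝ} (ht : 0 < t) (h : ∫⁻ ω, ENNReal.ofReal (Real.exp (Z ω ^ 2 / t ^ 2)) ∂μ ≤ 2)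
    (h1 : ∫ ω, Z ω ^ 2 ∂μ = 1) : 1 ≤ t := by
  have h' : ∫⁻ ω, ENNReal.ofReal (Real.exp (Z ω ^ 2 / t ^ 2)) ∂μ ≤ ENNReal.ofReal 2 := by
    simpa using h
  have hZi : Integrable (fun ω => Z ω ^ 2) μ := by
    by_contra hn
    rw [integral_undef hn] at h1
    exact zero_ne_one h1
  have h2 : ∫ ω, (Z ω ^ 2 / t ^ 2 + 1) ∂μ ≤ 2 :=
    (integral_mono ((hZi.div_const _).add (integrable_const 1))
      (integrable_of_lintegral_ofReal_le (by fun_prop) (fun ω => (Real.exp_pos _).le) h')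
      fun ω => Real.add_one_le_exp _).trans
      (integral_le_of_lintegral_ofReal_le (by fun_prop) (fun ω => (Real.exp_pos _).le)
        (by norm_num) h')
  rw [integral_add (hZi.div_const _) (integrable_const 1), integral_div, h1] at h2
  simp only [integral_const, probReal_univ, smul_eq_mul, mul_one] at h2
  have h3 : 1 / t ^ 2 ≤ 1 := by linarith
  rw [div_le_one (by positivity)] at h3
  nlinarith

/-- The second moment of a sub-Gaussian variable is controlled by its `p`-th moment. -/
lemma le_of_integral_abs_rpow_eq_one [IsProbabilityMeasure μ] {Z : Ω → ℝ} (hZ : Measurable Z)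
    {p κ σ : ℝ} (hp : 1 ≤ p) (hκ : 0 < κ) (hσ : 0 < σ) (h2 : ∫ ω, Z ω ^ 2 ∂μ = σ ^ 2)
    (h : ∫⁻ ω, ENNReal.ofReal (Real.exp (Z ω ^ 2 / (κ * σ) ^ 2)) ∂μ ≤ 2)
    (hI : ∫ ω, |Z ω| ^ p ∂μ = 1) : σ ≤ 11 * κ ^ 2 := by
  have h' : ∫⁻ ω, ENNReal.ofReal (Real.exp (Z ω ^ 2 / (κ * σ) ^ 2)) ∂μ ≤ ENNReal.ofReal 2 := by
    simpa using h
  have hE := integral_le_of_lintegral_ofReal_le (by fun_prop) (fun ω => (Real.exp_pos _).le)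
    (by norm_num) h'
  have hEi : Integrable (fun ω => Real.exp (Z ω ^ 2 / (κ * σ) ^ 2)) μ :=
    integrable_of_lintegral_ofReal_le (by fun_prop) (fun ω => (Real.exp_pos _).le) h'
  have hpi : Integrable (fun ω => |Z ω| ^ p) μ := by
    by_contra hn
    rw [integral_undef hn] at hI
    exact zero_ne_one hI
  have hZi : Integrable (fun ω => Z ω ^ 2) μ := by
    by_contra hn
    rw [integral_undef hn] at h2
    exact (pow_pos hσ 2).ne h2
  -- Split at `|Z| = b`: `Z² ≤ b |Z| + Z⁴ / b²`. The `p`-th moment gives `𝔼|Z| ≤ 2`, and this `b`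
  -- makes the fourth-moment term at most `4σ²/9`. Hence `5σ²/9 ≤ 6κ²σ`, so `σ ≤ (54/5) κ²`.
  set b := 3 * κ ^ 2 * σ with hb
  have hb0 : 0 < b := by positivity
  have hpt : ∀ ω, Z ω ^ 2
      ≤ b * (1 + |Z ω| ^ p) + (κ * σ) ^ 4 / b ^ 2 * 2 * Real.exp (Z ω ^ 2 / (κ * σ) ^ 2) := by
    intro ω
    have hz0 := abs_nonneg (Z ω)
    have h1 : |Z ω| ≤ 1 + |Z ω| ^ p := by
      rcases le_or_gt |Z ω| 1 with hz | hz
      · have : 0 ≤ |Z ω| ^ p := by positivity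
        linarith
      · have := Real.self_le_rpow_of_one_le hz.le hp
        linarith
    have h3 : (Z ω ^ 2 / (κ * σ) ^ 2) ^ 2 ≤ 2 * Real.exp (Z ω ^ 2 / (κ * σ) ^ 2) := by
      have := Real.pow_div_factorial_le_exp (x := Z ω ^ 2 / (κ * σ) ^ 2) (by positivity) 2
      norm_num at this
      linarith
    have h4 : Z ω ^ 4 / b ^ 2 ≤ (κ * σ) ^ 4 / b ^ 2 * 2 * Real.exp (Z ω ^ 2 / (κ * σ) ^ 2) := by
      calc Z ω ^ 4 / b ^ 2 = (κ * σ) ^ 4 / b ^ 2 * (Z ω ^ 2 / (κ * σ) ^ 2) ^ 2 := by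
            field_simp
        _ ≤ (κ * σ) ^ 4 / b ^ 2 * (2 * Real.exp (Z ω ^ 2 / (κ * σ) ^ 2)) := by gcongr
        _ = _ := by ring
    have h5 : Z ω ^ 2 ≤ b * |Z ω| + Z ω ^ 4 / b ^ 2 := by
      rcases le_or_gt |Z ω| b with hz | hz
      · have : 0 ≤ Z ω ^ 4 / b ^ 2 := by positivity
        rw [← sq_abs]
        nlinarith
      · have : Z ω ^ 2 ≤ Z ω ^ 4 / b ^ 2 := by
          rw [le_div_iff₀ (by positivity)]
          have : b ^ 2 ≤ Z ω ^ 2 := by rw [← sq_abs (Z ω)]; gcongr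
          nlinarith [sq_nonneg (Z ω)]
        have : 0 ≤ b * |Z ω| := by positivity
        linarith
    nlinarith [mul_le_mul_of_nonneg_left h1 hb0.le]
  have i1 : Integrable (fun ω => b * (1 + |Z ω| ^ p)) μ :=
    ((integrable_const (1 : ℝ)).add hpi).const_mul b
  have i2 : Integrable
      (fun ω => (κ * σ) ^ 4 / b ^ 2 * 2 * Real.exp (Z ω ^ 2 / (κ * σ) ^ 2)) μ := hEi.const_mul _
  have h6 := integral_mono hZi (i1.add i2) hpt
  simp only [Pi.add_apply] at h6
  rw [integral_add i1 i2, integral_const_mul, integral_const_mul,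
    integral_add (integrable_const _) hpi, hI, h2] at h6
  simp only [integral_const, probReal_univ, smul_eq_mul, mul_one] at h6
  have h7 : (κ * σ) ^ 4 / b ^ 2 * 2 * ∫ ω, Real.exp (Z ω ^ 2 / (κ * σ) ^ 2) ∂μ
      ≤ (κ * σ) ^ 4 / b ^ 2 * 2 * 2 := by gcongr
  have h8 : (κ * σ) ^ 4 / b ^ 2 = σ ^ 2 / 9 := by
    rw [hb]; field_simp; norm_num
  rw [h8] at h7 h6
  have h9 : σ * (5 * σ) ≤ σ * (54 * κ ^ 2) := by nlinarith
  have h10 := le_of_mul_le_mul_left h9 hσ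
  nlinarith [sq_nonneg κ]

variable {m n : ℕ} [NeZero m] [NeZero n]

variable {A : Ω → Matrix (Fin m) (Fin n) ℝ}

lemma measurable_rowForm (hA : IsIIDSubGaussianMatrix A μ) (x : EuclideanSpace ℝ (Fin n))
    (i : Fin m) : Measurable (rowForm A x i) :=
  Finset.measurable_sum _ fun j _ => (hA.measurable i j).mul_const _

lemma iIndepFun_rowForm_comp [IsProbabilityMeasure μ] (hA : IsIIDSubGaussianMatrix A μ)
    (x y : EuclideanSpace ℝ (Fin n)) {φ : ℝ → ℝ → ℝ} (hφ : Measurable (Function.uncurry φ)) :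
    iIndepFun (fun i ω => φ (rowForm A x i ω) (rowForm A y i ω)) μ := by
  have h := iIndepFun_curry (Y := fun i j ω => A ω i j) hA.measurable hA.indep
  exact h.comp (fun _ r => φ (∑ j, r j * x j) (∑ j, r j * y j)) fun _ =>
    hφ.comp (f := fun r : Fin n → ℝ => (∑ j, r j * x j, ∑ j, r j * y j)) (by fun_prop)

lemma identDistrib_rowForm [IsProbabilityMeasure μ] (hA : IsIIDSubGaussianMatrix A μ)
    (x : EuclideanSpace ℝ (Fin n)) (i : Fin m) :
    IdentDistrib (rowForm A x i) (rowForm A x 0) μ μ := by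
  have hrow : ∀ i, iIndepFun (fun j ω => A ω i j) μ := fun i =>
    hA.indep.precomp (g := fun j => (i, j)) fun a b hab => (Prod.mk.inj hab).2
  have h := IdentDistrib.pi (fun j => (hA.identDistrib i j).trans (hA.identDistrib 0 j).symm)
    (hrow i) (hrow 0)
  exact h.comp (u := fun r : Fin n → ℝ => ∑ j, r j * x j) (by fun_prop)

lemma integral_sq_entry (hA : IsIIDSubGaussianMatrix A μ) : ∫ ω, A ω 0 0 ^ 2 ∂μ = 1 := by
  rw [← hA.unit_variance, variance_of_integral_eq_zero (hA.measurable 0 0).aemeasurable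
    hA.mean_zero]

/-- There is an admissible parameter in the definition of the `ψ₂` norm of the entries which is
at most twice that norm. -/
lemma exists_entry_parameter [IsProbabilityMeasure μ] (hA : IsIIDSubGaussianMatrix A μ) :
    ∃ t : ℝ, 1 ≤ t ∧ t ≤ 2 * entryNorm A μ ∧
      ∫⁻ ω, ENNReal.ofReal (Real.exp (A ω 0 0 ^ 2 / t ^ 2)) ∂μ ≤ 2 := by
  have hset : ∀ t : ℝ, 0 < t →
      ∫⁻ ω, ENNReal.ofReal (Real.exp (|A ω 0 0| ^ (2 : ℝ) / t ^ (2 : ℝ))) ∂μ ≤ 2 →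
      1 ≤ t ∧ ∫⁻ ω, ENNReal.ofReal (Real.exp (A ω 0 0 ^ 2 / t ^ 2)) ∂μ ≤ 2 := by
    intro t ht h
    simp only [Real.rpow_two, sq_abs] at h
    exact ⟨one_le_of_lintegral_exp_sq_le (hA.measurable 0 0) ht h (integral_sq_entry hA), h⟩
  have hfin := hA.subGaussian
  have h1 : 1 ≤ orliczNorm 2 (fun ω => A ω 0 0) μ := by
    refine le_sInf ?_
    rintro _ ⟨t, ⟨ht, h⟩, rfl⟩
    exact ENNReal.one_le_ofReal.2 (hset t ht h).1
  -- The norm lies in `[1, ∞)`, so doubling it leaves room for an admissible parameter without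
  -- showing that the infimum is attained.
  have hlt : orliczNorm 2 (fun ω => A ω 0 0) μ < 2 * orliczNorm 2 (fun ω => A ω 0 0) μ := by
    rw [two_mul]
    exact ENNReal.lt_add_right hfin.ne (zero_lt_one.trans_le h1).ne'
  obtain ⟨_, ⟨t, ⟨ht, h⟩, rfl⟩, hlt'⟩ := sInf_lt_iff.1 hlt
  refine ⟨t, (hset t ht h).1, ?_, (hset t ht h).2⟩
  have h2 := (ENNReal.ofReal_lt_iff_lt_toReal ht.le (ENNReal.mul_ne_top (by simp) hfin.ne)).1 hlt'
  rw [ENNReal.toReal_mul] at h2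
  simpa [entryNorm] using h2.le

lemma hasSubgaussianMGF_entry [IsProbabilityMeasure μ] (hA : IsIIDSubGaussianMatrix A μ)
    {t : ℝ} (ht : 0 < t) (h : ∫⁻ ω, ENNReal.ofReal (Real.exp (A ω 0 0 ^ 2 / t ^ 2)) ∂μ ≤ 2)
    (i : Fin m) (j : Fin n) :
    HasSubgaussianMGF (fun ω => A ω i j) (Real.toNNReal (2 * t ^ 2)) μ :=
  (hasSubgaussianMGF_of_lintegral_exp_sq_le (hA.measurable 0 0) ht h
    hA.mean_zero).congr_identDistrib (hA.identDistrib i j).symm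

lemma lintegral_exp_rowForm_sq_le [IsProbabilityMeasure μ] (hA : IsIIDSubGaussianMatrix A μ)
    {t : ℝ} (ht : 0 < t) (h : ∫⁻ ω, ENNReal.ofReal (Real.exp (A ω 0 0 ^ 2 / t ^ 2)) ∂μ ≤ 2)
    (x : EuclideanSpace ℝ (Fin n)) {d : ℝ} (hd : 0 < d) (hx : ‖x‖ ≤ d) (i : Fin m) :
    ∫⁻ ω, ENNReal.ofReal (Real.exp (rowForm A x i ω ^ 2 / (4 * t * d) ^ 2)) ∂μ ≤ 2 := by
  have hrow : iIndepFun (fun j ω => x j * A ω i j) μ :=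
    (hA.indep.precomp (g := fun j => (i, j)) fun a b hab => (Prod.mk.inj hab).2).comp
      (fun j z => x j * z) fun j => by fun_prop
  have hsum := HasSubgaussianMGF.sum_of_iIndepFun hrow (s := Finset.univ)
    (c := fun j => Real.toNNReal (x j ^ 2 * (2 * t ^ 2))) fun j _ => by
      have hj := hasSubgaussianMGF_entry hA ht h i j
      refine ⟨fun l => by simpa [mul_assoc] using hj.integrable_exp_mul (l * x j), fun l => ?_⟩
      rw [mgf_const_mul]
      refine (hj.mgf_le _).trans_eq ?_
      rw [Real.coe_toNNReal _ (by positivity), Real.coe_toNNReal _ (by positivity)]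
      ring_nf
  have hsub : HasSubgaussianMGF (rowForm A x i) (Real.toNNReal ((Real.sqrt 2 * t * d) ^ 2)) μ := by
    have e : (fun ω => ∑ j, x j * A ω i j) = rowForm A x i := by
      funext ω; simp [rowForm, mul_comm]
    rw [e] at hsum
    refine ⟨hsum.integrable_exp_mul, fun l => (hsum.mgf_le l).trans (Real.exp_le_exp.2 ?_)⟩
    gcongr
    rw [← NNReal.coe_le_coe, NNReal.coe_sum, Real.coe_toNNReal _ (by positivity)]
    rw [Finset.sum_congr rfl fun j _ => Real.coe_toNNReal (x j ^ 2 * (2 * t ^ 2)) (by positivity),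
      ← Finset.sum_mul, mul_pow, mul_pow, Real.sq_sqrt (by norm_num)]
    have : ∑ j, x j ^ 2 ≤ d ^ 2 := by
      rw [← EuclideanSpace.real_norm_sq_eq]; gcongr
    nlinarith [sq_nonneg t]
  have h2 := lintegral_exp_sq_le_of_hasSubgaussianMGF (measurable_rowForm hA x i)
    (by positivity) hsub
  convert h2 using 6
  rw [mul_pow, mul_pow, mul_pow, mul_pow, Real.sq_sqrt (by norm_num)]
  ring

lemma integral_rowForm_sq [IsProbabilityMeasure μ] (hA : IsIIDSubGaussianMatrix A μ)
    {t : ℝ} (ht : 0 < t) (h : ∫⁻ ω, ENNReal.ofReal (Real.exp (A ω 0 0 ^ 2 / t ^ 2)) ∂μ ≤ 2)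
    (x : EuclideanSpace ℝ (Fin n)) (i : Fin m) :
    ∫ ω, rowForm A x i ω ^ 2 ∂μ = ‖x‖ ^ 2 := by
  have hrow : iIndepFun (fun j ω => x j * A ω i j) μ :=
    (hA.indep.precomp (g := fun j => (i, j)) fun a b hab => (Prod.mk.inj hab).2).comp
      (fun j z => x j * z) fun j => by fun_prop
  have hL : ∀ j, MemLp (fun ω => A ω i j) 2 μ := fun j =>
    (hasSubgaussianMGF_entry hA ht h i j).memLp 2
  have e : rowForm A x i = ∑ j, fun ω => x j * A ω i j := by
    funext ω; simp [rowForm, mul_comm]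
  have hmean : ∫ ω, rowForm A x i ω ∂μ = 0 := by
    simp only [rowForm]
    rw [integral_finsetSum _ fun j _ => ((hL j).integrable (by norm_num)).mul_const _]
    refine Finset.sum_eq_zero fun j _ => ?_
    rw [integral_mul_const, (hA.identDistrib i j).integral_eq, hA.mean_zero, zero_mul]
  rw [← variance_of_integral_eq_zero (measurable_rowForm hA x i).aemeasurable hmean, e,
    IndepFun.variance_sum (fun j _ => (hL j).const_mul (x j))
      fun j _ k _ hjk => hrow.indepFun hjk, EuclideanSpace.real_norm_sq_eq]
  refine Finset.sum_congr rfl fun j _ => ?_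
  rw [variance_const_mul, (hA.identDistrib i j).variance_eq, hA.unit_variance, mul_one]

lemma integral_abs_rowForm_rpow [IsProbabilityMeasure μ] (hA : IsIIDSubGaussianMatrix A μ)
    {p : ℝ} (hp : 1 ≤ p) {x : EuclideanSpace ℝ (Fin n)} (hx : x ∈ rowSphere p A μ) (i : Fin m) :
    ∫ ω, |rowForm A x i ω| ^ p ∂μ = 1 := by
  have h1 : ∫ ω, |rowForm A x i ω| ^ p ∂μ = ∫ ω, |rowForm A x 0 ω| ^ p ∂μ :=
    ((identDistrib_rowForm hA x i).comp (u := fun z => |z| ^ p) (by fun_prop)).integral_eq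
  rw [h1]
  have h2 : (∫ ω, |rowForm A x 0 ω| ^ p ∂μ) ^ (1 / p) = 1 := hx
  have h3 : 0 ≤ ∫ ω, |rowForm A x 0 ω| ^ p ∂μ := integral_nonneg fun ω => by positivity
  calc ∫ ω, |rowForm A x 0 ω| ^ p ∂μ = ((∫ ω, |rowForm A x 0 ω| ^ p ∂μ) ^ (1 / p)) ^ p := by
        rw [← Real.rpow_mul h3, one_div_mul_cancel (by linarith), Real.rpow_one]
    _ = 1 := by rw [h2, Real.one_rpow]

/-- The second moment of `A₁x` is `‖x‖²` and its `ψ₂` norm is at most `4t ‖x‖`, so the moment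
comparison applies with `κ = 4t`; `176 = 11 · 4²`. -/
lemma norm_le_of_mem_rowSphere [IsProbabilityMeasure μ] (hA : IsIIDSubGaussianMatrix A μ)
    {t : ℝ} (ht : 0 < t) (h : ∫⁻ ω, ENNReal.ofReal (Real.exp (A ω 0 0 ^ 2 / t ^ 2)) ∂μ ≤ 2)
    {p : ℝ} (hp : 1 ≤ p) {x : EuclideanSpace ℝ (Fin n)} (hx : x ∈ rowSphere p A μ) :
    ‖x‖ ≤ 176 * t ^ 2 := by
  rcases eq_or_ne x 0 with rfl | hx0
  · rw [norm_zero]; positivity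
  have hn : 0 < ‖x‖ := norm_pos_iff.2 hx0
  have := le_of_integral_abs_rpow_eq_one (κ := 4 * t) (measurable_rowForm hA x 0) hp
    (by positivity) hn (integral_rowForm_sq hA ht h x 0)
    (lintegral_exp_rowForm_sq_le hA ht h x hn le_rfl 0) (integral_abs_rowForm_rpow hA hp hx 0)
  linarith

end LinearForms

/-! ### Elementary inequalities for powers and `ℓ_p` sums. -/

section PowerInequalities

lemma rpow_sub_rpow_le {a b p : ℝ} (hp : 1 ≤ p) (hb : 0 ≤ b) (hab : b ≤ a) :
    a ^ p - b ^ p ≤ p * (a - b) * a ^ (p - 1) := by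
  rcases (hb.trans hab).eq_or_lt with ha | ha
  · have hb' : b = 0 := le_antisymm (ha ▸ hab) hb
    rw [← ha, hb']; simp
  have h := one_add_mul_self_le_rpow_one_add (s := b / a - 1)
    (by have : 0 ≤ b / a := by positivity
        linarith) hp
  rw [add_sub_cancel, Real.div_rpow hb ha.le, le_div_iff₀ (by positivity)] at h
  have e : a ^ p = a ^ (p - 1) * a := by
    rw [← Real.rpow_add_one ha.ne']; simp
  have e2 : (1 + p * (b / a - 1)) * a ^ p = a ^ p + p * (b - a) * a ^ (p - 1) := by
    rw [e]; field_simp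
  rw [e2] at h
  linarith

lemma abs_abs_rpow_sub_abs_rpow_le {p : ℝ} (hp : 1 ≤ p) (a b : ℝ) :
    |(|a| ^ p - |b| ^ p)| ≤ p * |a - b| * max |a| |b| ^ (p - 1) := by
  have key : ∀ u v : ℝ, |v| ≤ |u| →
      |(|u| ^ p - |v| ^ p)| ≤ p * |u - v| * max |u| |v| ^ (p - 1) := by
    intro u v h
    rw [max_eq_left h, abs_of_nonneg (sub_nonneg.2 (Real.rpow_le_rpow (abs_nonneg v) h
      (by linarith)))]
    refine (rpow_sub_rpow_le hp (abs_nonneg v) h).trans ?_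
    gcongr
    exact abs_sub_abs_le_abs_sub u v
  rcases le_total |b| |a| with h | h
  · exact key a b h
  · rw [abs_sub_comm, abs_sub_comm a b, max_comm]
    exact key b a h

/-- The weight involves `a` alone, so linearising the root needs a lower bound on only one of the
two norms. -/
lemma rpow_mul_abs_sub_le {a b p : ℝ} (hp : 1 ≤ p) (ha : 0 ≤ a) (hb : 0 ≤ b) :
    a ^ (p - 1) * |a - b| ≤ |a ^ p - b ^ p| := by
  have hsplit : ∀ u : ℝ, 0 ≤ u → u ^ p = u ^ (p - 1) * u := by
    intro u hu
    rcases hu.eq_or_lt with h | h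
    · rw [← h, mul_zero, Real.zero_rpow (by linarith)]
    · rw [← Real.rpow_add_one h.ne']; simp
  rcases le_total b a with h | h
  · rw [abs_of_nonneg (sub_nonneg.2 h)]
    refine le_trans ?_ (le_abs_self _)
    have : b ^ (p - 1) ≤ a ^ (p - 1) := Real.rpow_le_rpow hb h (by linarith)
    rw [hsplit a ha, hsplit b hb]
    nlinarith
  · rw [abs_sub_comm, abs_of_nonneg (sub_nonneg.2 h), abs_sub_comm]
    refine le_trans ?_ (le_abs_self _)
    have : a ^ (p - 1) ≤ b ^ (p - 1) := Real.rpow_le_rpow ha h (by linarith)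
    rw [hsplit a ha, hsplit b hb]
    nlinarith

lemma sum_rpow_rpow_le {m : ℕ} {p r : ℝ} (hp : 1 ≤ p) (hpr : p ≤ r) (v : Fin m → ℝ) :
    (∑ i, |v i| ^ p) ^ (1 / p) ≤ (m : ℝ) ^ (1 / p - 1 / r) * (∑ i, |v i| ^ r) ^ (1 / r) := by
  have hp0 : 0 < p := by linarith
  have hr0 : 0 < r := by linarith
  have h := Real.rpow_sum_le_const_mul_sum_rpow Finset.univ (fun i => |v i| ^ p)
    ((one_le_div hp0).2 hpr)
  have h0 : ∀ i, 0 ≤ |v i| ^ p := fun i => by positivity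
  simp only [Finset.card_univ, Fintype.card_fin] at h
  have e : ∀ i, |(|v i| ^ p)| ^ (r / p) = |v i| ^ r := fun i => by
    rw [abs_of_nonneg (h0 i), ← Real.rpow_mul (abs_nonneg _), mul_div_cancel₀ _ hp0.ne']
  simp only [e] at h
  rw [Finset.sum_congr rfl fun i _ => abs_of_nonneg (h0 i)] at h
  have hs : 0 ≤ ∑ i, |v i| ^ p := Finset.sum_nonneg fun i _ => h0 i
  have hs' : 0 ≤ ∑ i, |v i| ^ r := Finset.sum_nonneg fun i _ => by positivity
  have h2 := Real.rpow_le_rpow (by positivity) h (one_div_nonneg.2 hr0.le)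
  rw [← Real.rpow_mul hs, Real.mul_rpow (by positivity) hs', ← Real.rpow_mul (by positivity)] at h2
  convert h2 using 2
  · field_simp
  · congr 1; field_simp

lemma abs_sum_rpow_rpow_sub_le {m : ℕ} {p : ℝ} (hp : 1 ≤ p) (u v : Fin m → ℝ) :
    |(∑ i, |u i| ^ p) ^ (1 / p) - (∑ i, |v i| ^ p) ^ (1 / p)|
      ≤ (∑ i, |u i - v i| ^ p) ^ (1 / p) := by
  have h1 := Real.Lp_add_le Finset.univ (fun i => u i - v i) v hp
  have h2 := Real.Lp_add_le Finset.univ (fun i => v i - u i) u hp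
  simp only [sub_add_cancel, abs_sub_comm (v _) (u _)] at h1 h2
  rw [abs_le]
  constructor <;> linarith

end PowerInequalities

/-! ### Large deviations of `ℓ_r` norms. -/

section Tails

lemma lintegral_exp_le_nine {Ω : Type*} [MeasurableSpace Ω] {μ : Measure Ω}
    [IsProbabilityMeasure μ] {F f g h : Ω → ℝ}
    (hf : Measurable f) (hg : Measurable g) (hF : ∀ ω, F ω ≤ max 1 (max (f ω) (max (g ω) (h ω))))
    (h1 : ∫⁻ ω, ENNReal.ofReal (Real.exp (f ω)) ∂μ ≤ 2)
    (h2 : ∫⁻ ω, ENNReal.ofReal (Real.exp (g ω)) ∂μ ≤ 2)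
    (h3 : ∫⁻ ω, ENNReal.ofReal (Real.exp (h ω)) ∂μ ≤ 2) :
    ∫⁻ ω, ENNReal.ofReal (Real.exp (F ω)) ∂μ ≤ ENNReal.ofReal 9 := by
  calc ∫⁻ ω, ENNReal.ofReal (Real.exp (F ω)) ∂μ
      ≤ ∫⁻ ω, (3 + (ENNReal.ofReal (Real.exp (f ω)) + (ENNReal.ofReal (Real.exp (g ω))
          + ENNReal.ofReal (Real.exp (h ω))))) ∂μ := by
        refine lintegral_mono fun ω => ?_
        rw [show (3 : ℝ≥0∞) = ENNReal.ofReal 3 by simp,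
          ← ENNReal.ofReal_add (Real.exp_pos _).le (Real.exp_pos _).le,
          ← ENNReal.ofReal_add (Real.exp_pos _).le (by positivity),
          ← ENNReal.ofReal_add (by norm_num) (by positivity)]
        refine ENNReal.ofReal_le_ofReal ?_
        have e1 := Real.exp_one_lt_d9
        have e2 := Real.exp_pos (f ω)
        have e3 := Real.exp_pos (g ω)
        have e4 := Real.exp_pos (h ω)
        have hF' := hF ω
        simp only [le_max_iff] at hF'
        rcases hF' with h | h | h | h <;> have := Real.exp_le_exp.2 h <;> linarith
    _ ≤ 3 + (2 + (2 + 2)) := by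
        rw [lintegral_add_left measurable_const, lintegral_add_left (by fun_prop),
          lintegral_add_left (by fun_prop)]
        simp only [lintegral_const, measure_univ, mul_one]
        gcongr
    _ = ENNReal.ofReal 9 := by
        rw [show ENNReal.ofReal 9 = 9 by simp]; norm_num

/-- Tail of the `ℓ_r` norm, `r ≥ 2`, of a vector with independent sub-Gaussian coordinates. -/
theorem exists_measure_sum_rpow_ge_le {r : ℝ} (hr : 2 ≤ r) :
    ∃ C c b : ℝ, 1 ≤ C ∧ 0 < c ∧ 1 ≤ b ∧ ∀ {Ω : Type*} [MeasurableSpace Ω] (μ : Measure Ω)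
      [IsProbabilityMeasure μ] (m : ℕ) (g : Fin m → Ω → ℝ) (κ : ℝ), 0 < m → 0 < κ →
      (∀ i, Measurable (g i)) → iIndepFun g μ →
      (∀ i, ∫⁻ ω, ENNReal.ofReal (Real.exp (g i ω ^ 2 / κ ^ 2)) ∂μ ≤ 2) →
      ∀ s : ℝ, 0 ≤ s → (m : ℝ) ≤ s ^ r →
      μ {ω | b * κ * s ≤ (∑ i, |g i ω| ^ r) ^ (1 / r)}
        ≤ ENNReal.ofReal (C * Real.exp (-(c * s ^ 2))) := by
  have hr0 : 0 < r := by linarith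
  obtain ⟨M, hM1, hM⟩ := exists_rpow_le_mul_exp (a := r / 2) (by positivity)
  obtain ⟨C, c, hC, hc, H⟩ := exists_measure_sum_ge_le (α := 2 / r) (G := 9) (by positivity)
    ((div_le_one hr0).2 hr) (by norm_num)
  refine ⟨C, c, 4 * M, hC, hc, by linarith, ?_⟩
  intro Ω _ μ _ m g κ hm hκ hg hind hexp s hs hms
  have hm1 : (1 : ℝ) ≤ m := Nat.one_le_cast.2 hm
  have hs1 : 1 ≤ s := by
    by_contra hlt
    push Not at hlt
    have := Real.rpow_lt_one hs hlt hr0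
    linarith
  -- Dividing by `2M` makes the mean of the power at most `1`, so `φ (g i)` has non-positive mean;
  -- it is `ψ_{2/r}` because `g i` is `ψ₂`.
  set φ : ℝ → ℝ := fun z => (|z| / κ) ^ r / (2 * M) - 1 with hφ
  have hφm : Measurable φ := by fun_prop
  have hsq : ∀ z : ℝ, ((|z| / κ) ^ r) ^ (2 / r) = z ^ 2 / κ ^ 2 := by
    intro z
    rw [← Real.rpow_mul (by positivity), mul_div_cancel₀ _ hr0.ne', Real.rpow_two, div_pow, sq_abs]
  have hφabs : ∀ z, |φ z| ^ (2 / r) ≤ max 1 (z ^ 2 / κ ^ 2) := by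
    intro z
    have h0 : 0 ≤ (|z| / κ) ^ r := by positivity
    have h1 : (|z| / κ) ^ r / (2 * M) ≤ (|z| / κ) ^ r := div_le_self h0 (by linarith)
    have h2 : 0 ≤ (|z| / κ) ^ r / (2 * M) := by positivity
    have h3 : |φ z| ≤ max 1 ((|z| / κ) ^ r) := by
      rw [abs_le]
      refine ⟨?_, ?_⟩
      · have := le_max_left 1 ((|z| / κ) ^ r)
        simp only [hφ]; linarith
      · have := le_max_right 1 ((|z| / κ) ^ r)
        simp only [hφ]; linarith
    rcases le_total 1 ((|z| / κ) ^ r) with h4 | h4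
    · rw [max_eq_right h4] at h3
      refine le_trans ?_ (le_max_right _ _)
      rw [← hsq z]
      exact Real.rpow_le_rpow (abs_nonneg _) h3 (by positivity)
    · rw [max_eq_left h4] at h3
      exact (Real.rpow_le_one (abs_nonneg _) h3 (by positivity)).trans (le_max_left _ _)
  have hmean : ∀ i, ∫ ω, φ (g i ω) ∂μ ≤ 0 := by
    intro i
    have hgi := hg i
    have hexp' : ∫⁻ ω, ENNReal.ofReal (Real.exp (g i ω ^ 2 / κ ^ 2)) ∂μ ≤ ENNReal.ofReal 2 := by
      simpa using hexp i
    have hEi := integrable_of_lintegral_ofReal_le (by fun_prop) (fun ω => (Real.exp_pos _).le)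
      hexp'
    have hE := integral_le_of_lintegral_ofReal_le (by fun_prop) (fun ω => (Real.exp_pos _).le)
      (by norm_num) hexp'
    have hpt : ∀ ω, (|g i ω| / κ) ^ r / (2 * M) ≤ 1 / 2 * Real.exp (g i ω ^ 2 / κ ^ 2) := by
      intro ω
      have h1 := hM (g i ω ^ 2 / κ ^ 2) (by positivity)
      rw [← hsq (g i ω), ← Real.rpow_mul (by positivity), div_mul_div_comm, mul_comm 2 r,
        div_self (by positivity), Real.rpow_one, hsq] at h1
      rw [div_le_iff₀ (by positivity)]
      linarith
    have hint : Integrable (fun ω => (|g i ω| / κ) ^ r / (2 * M)) μ := by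
      refine (hEi.const_mul (1 / 2)).mono' (Measurable.aestronglyMeasurable (by fun_prop))
        (ae_of_all _ fun ω => ?_)
      rw [Real.norm_eq_abs, abs_of_nonneg (by positivity)]
      exact hpt ω
    have h2 := integral_mono hint (hEi.const_mul (1 / 2)) hpt
    rw [integral_const_mul] at h2
    simp only [hφ]
    rw [integral_sub hint (integrable_const _)]
    simp only [integral_const, probReal_univ, smul_eq_mul, mul_one]
    linarith
  have key := H μ m (fun i ω => φ (g i ω)) hm (fun i => hφm.comp (hg i))
    (hind.comp (fun _ => φ) fun _ => hφm)
    (fun i => by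
      have hgi := hg i
      exact lintegral_exp_le_nine (by fun_prop) (by fun_prop)
        (fun ω => by simpa using hφabs (g i ω)) (hexp i) (hexp i) (hexp i))
    hmean (s ^ r) (by positivity)
  -- At deviation `s^r`, the condition `m ≤ s^r` makes both branches of the minimum at least `s²`.
  have hmin : s ^ 2 ≤ min ((s ^ r) ^ 2 / m) ((s ^ r) ^ (2 / r)) := by
    refine le_min ?_ ?_
    · rw [le_div_iff₀ (by linarith), sq (s ^ r)]
      have : s ^ 2 ≤ s ^ r := by
        rw [← Real.rpow_two]; exact Real.rpow_le_rpow_of_exponent_le hs1 hr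
      exact mul_le_mul this hms (by positivity) (by positivity)
    · rw [← Real.rpow_mul hs, mul_div_cancel₀ _ hr0.ne', Real.rpow_two]
  refine (measure_mono fun ω hω => ?_).trans (key.trans (ENNReal.ofReal_le_ofReal ?_))
  · simp only [Set.mem_ofPred_eq] at hω ⊢
    have hS : 0 ≤ ∑ i, |g i ω| ^ r := Finset.sum_nonneg fun i _ => by positivity
    have h1 := Real.rpow_le_rpow (by positivity) hω hr0.le
    rw [← Real.rpow_mul hS, one_div_mul_cancel hr0.ne', Real.rpow_one,
      Real.mul_rpow (by positivity) hs, Real.mul_rpow (by positivity) hκ.le] at h1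
    have h2 : 4 * M ≤ (4 * M) ^ r := Real.self_le_rpow_of_one_le (by linarith) (by linarith)
    have h3 : 4 * M * κ ^ r * s ^ r ≤ ∑ i, |g i ω| ^ r := by
      refine le_trans ?_ h1
      gcongr
    have h4 : ∑ i, φ (g i ω) = (∑ i, |g i ω| ^ r) / κ ^ r / (2 * M) - m := by
      simp only [hφ, Finset.sum_sub_distrib, Finset.sum_const, Finset.card_univ, Fintype.card_fin,
        nsmul_eq_mul, mul_one, Finset.sum_div]
      congr 1
      refine Finset.sum_congr rfl fun i _ => ?_
      rw [Real.div_rpow (abs_nonneg _) hκ.le]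
    rw [h4]
    have h5 : 2 * s ^ r ≤ (∑ i, |g i ω| ^ r) / κ ^ r / (2 * M) := by
      rw [le_div_iff₀ (by positivity), le_div_iff₀ (by positivity)]
      linarith
    linarith
  · gcongr

end Tails

/-! ### Tail of the difference of two `ℓ_p` norms. -/

section Increment

/-- A `p`-th power of a `ψ₂` variable is `ψ_{2/p}`; capping the exponent at `2 / max p 2 ≤ 1` puts
it in the range of the truncation bound also when `p < 2`. -/
lemma rpow_two_div_max_le {p w : ℝ} (hp : 1 ≤ p) (hw : 0 ≤ w) :
    (w ^ p) ^ (2 / max p 2) ≤ max 1 (w ^ 2) := by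
  have hr0 : 0 < max p 2 := lt_max_of_lt_right two_pos
  rw [← Real.rpow_mul hw]
  rcases le_total w 1 with h | h
  · exact (Real.rpow_le_one hw h (by positivity)).trans (le_max_left _ _)
  · refine le_trans ?_ (le_max_right _ _)
    rw [← Real.rpow_two]
    refine Real.rpow_le_rpow_of_exponent_le h ?_
    rw [← mul_div_assoc, div_le_iff₀ hr0, mul_comm]
    exact mul_le_mul_of_nonneg_left (le_max_left _ _) two_pos.le

variable {Ω : Type*} [MeasurableSpace Ω] {μ : Measure Ω}

lemma lintegral_exp_abs_le_nine [IsProbabilityMeasure μ] {D f g h : Ω → ℝ} {p : ℝ} (hp : 1 ≤ p)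
    (hf : Measurable f) (hg : Measurable g)
    (hD : ∀ ω, |D ω| ≤ max 1 (max |f ω| (max |g ω| |h ω|)) ^ p)
    (h1 : ∫⁻ ω, ENNReal.ofReal (Real.exp (f ω ^ 2)) ∂μ ≤ 2)
    (h2 : ∫⁻ ω, ENNReal.ofReal (Real.exp (g ω ^ 2)) ∂μ ≤ 2)
    (h3 : ∫⁻ ω, ENNReal.ofReal (Real.exp (h ω ^ 2)) ∂μ ≤ 2) :
    ∫⁻ ω, ENNReal.ofReal (Real.exp (|D ω| ^ (2 / max p 2))) ∂μ ≤ ENNReal.ofReal 9 := by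
  refine lintegral_exp_le_nine (hf.pow_const 2) (hg.pow_const 2) (fun ω => ?_) h1 h2 h3
  have hw : 0 ≤ max 1 (max |f ω| (max |g ω| |h ω|)) := zero_le_one.trans (le_max_left _ _)
  refine (Real.rpow_le_rpow (abs_nonneg _) (hD ω) (by positivity)).trans
    ((rpow_two_div_max_le hp hw).trans ?_)
  have key : ∀ a b : ℝ, max a b ^ 2 ≤ max (a ^ 2) (b ^ 2) := fun a b => by
    rcases max_choice a b with h | h <;> rw [h]
    exacts [le_max_left _ _, le_max_right _ _]
  refine max_le (le_max_left _ _) ?_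
  simp only [← sq_abs (f ω), ← sq_abs (g ω), ← sq_abs (h ω)]
  refine (key _ _).trans (max_le_max (one_pow 2).le ((key _ _).trans ?_))
  exact max_le_max le_rfl (key _ _)

/-- Two-sided version of `exists_measure_sum_ge_le`. -/
theorem exists_measure_abs_sum_ge_le {α G : ℝ} (hα0 : 0 < α) (hα1 : α ≤ 1) (hG : 1 ≤ G) :
    ∃ C c : ℝ, 1 ≤ C ∧ 0 < c ∧ ∀ {Ω : Type*} [MeasurableSpace Ω] (μ : Measure Ω)
      [IsProbabilityMeasure μ] (m : ℕ) (Y : Fin m → Ω → ℝ), 0 < m →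
      (∀ i, Measurable (Y i)) → iIndepFun Y μ →
      (∀ i, ∫⁻ ω, ENNReal.ofReal (Real.exp (|Y i ω| ^ α)) ∂μ ≤ ENNReal.ofReal G) →
      (∀ i, ∫ ω, Y i ω ∂μ = 0) → ∀ t : ℝ, 0 ≤ t →
      μ {ω | t ≤ |∑ i, Y i ω|}
        ≤ ENNReal.ofReal (C * Real.exp (-(c * min (t ^ 2 / m) (t ^ α)))) := by
  obtain ⟨C, c, hC, hc, H⟩ := exists_measure_sum_ge_le hα0 hα1 hG
  refine ⟨C + C, c, by linarith, hc, ?_⟩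
  intro Ω _ μ _ m Y hm hY hind hexp hmean t ht
  have h1 := H μ m Y hm hY hind hexp (fun i => (hmean i).le) t ht
  have h2 := H μ m (fun i ω => -Y i ω) hm (fun i => (hY i).neg)
    (hind.comp (fun _ z => -z) fun _ => measurable_neg) (fun i => by simpa using hexp i)
    (fun i => by rw [integral_neg, hmean i, neg_zero]) t ht
  rw [add_mul, ENNReal.ofReal_add (by positivity) (by positivity)]
  refine (measure_mono fun ω hω => ?_).trans ((measure_union_le _ _).trans (add_le_add h1 h2))
  simp only [Set.mem_union, Set.mem_ofPred_eq, Finset.sum_neg_distrib] at hω ⊢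
  exact le_abs.1 hω

/-- Both branches are Gaussian in the regime `(βs)^r ≤ M`: the first since `M ≤ M^(2 - 2/r)`, the
second since `(βs)^r = βs (βs)^(r-1) ≤ βs M^(1 - 1/r) ≤ t`. -/
lemma sq_le_min_of_le {r M β s u t : ℝ} (hr : 2 ≤ r) (hM : 1 ≤ M) (hβ : 0 ≤ β) (hs : 0 ≤ s)
    (hu : β * s ≤ u) (huM : u ^ r ≤ M) (ht : β * s * M ^ (1 - 1 / r) ≤ t) :
    (β * s) ^ 2 ≤ min (t ^ 2 / M) (t ^ (2 / r)) := by
  have hr0 : 0 < r := by linarith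
  have hM0 : 0 < M := by linarith
  have hx : 0 ≤ β * s := by positivity
  have hr1 : 1 / r ≤ 1 / 2 := one_div_le_one_div_of_le two_pos hr
  refine le_min ?_ ?_
  · rw [le_div_iff₀ hM0]
    have h1 : M ≤ (M ^ (1 - 1 / r)) ^ 2 := by
      rw [← Real.rpow_natCast, ← Real.rpow_mul hM0.le]
      refine Real.self_le_rpow_of_one_le hM ?_
      push_cast; linarith
    calc (β * s) ^ 2 * M ≤ (β * s) ^ 2 * (M ^ (1 - 1 / r)) ^ 2 := by gcongr
      _ = (β * s * M ^ (1 - 1 / r)) ^ 2 := by ring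
      _ ≤ t ^ 2 := by gcongr
  · have h1 : (β * s) ^ (r - 1) ≤ M ^ (1 - 1 / r) := by
      have h2 : ((β * s) ^ r) ^ (1 - 1 / r) ≤ M ^ (1 - 1 / r) :=
        Real.rpow_le_rpow (by positivity) ((Real.rpow_le_rpow hx hu hr0.le).trans huM)
          (by linarith)
      rwa [← Real.rpow_mul hx, mul_sub, mul_one, mul_one_div_cancel hr0.ne'] at h2
    have h3 : (β * s) ^ r ≤ t := by
      refine le_trans ?_ ht
      rcases hx.eq_or_lt with h | h
      · rw [← h, zero_mul, Real.zero_rpow hr0.ne']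
      · calc (β * s) ^ r = β * s * (β * s) ^ (r - 1) := by
              rw [mul_comm (β * s) ((β * s) ^ (r - 1)), ← Real.rpow_add_one h.ne']; simp
          _ ≤ _ := by gcongr
    calc (β * s) ^ 2 = ((β * s) ^ r) ^ (2 / r) := by
          rw [← Real.rpow_mul hx, mul_div_cancel₀ _ hr0.ne', Real.rpow_two]
      _ ≤ _ := Real.rpow_le_rpow (by positivity) h3 (by positivity)

/-- Used for the event that the `p`-th power sum drops below half its mean. Normalising the summands
by `h = H^p` shrinks the deviation to `M / (2h)`, which is why `h` enters the threshold `u`. -/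
lemma sq_div_four_le_min_of_le {r M β h s u : ℝ} (hr : 2 ≤ r) (hM : 1 ≤ M) (hh : 1 ≤ h)
    (hβ : 0 ≤ β) (hs : 0 ≤ s) (hu : β * h * s ≤ u) (huM : u ^ r ≤ M) :
    (β * s) ^ 2 / 4 ≤ min ((M / (2 * h)) ^ 2 / M) ((M / (2 * h)) ^ (2 / r)) := by
  have hr0 : 0 < r := by linarith
  have hM0 : 0 < M := by linarith
  have hh0 : 0 < h := by linarith
  have hu0 : 0 ≤ u := hu.trans' (by positivity)
  have h2r : 2 / r ≤ 1 := (div_le_one hr0).2 hr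
  have h1 : (β * s) ^ 2 / 4 ≤ M ^ (2 / r) / (2 * h) ^ 2 := by
    rw [le_div_iff₀ (by positivity)]
    have h2 := Real.rpow_le_rpow (z := 2 / r) (by positivity) huM (by positivity)
    rw [← Real.rpow_mul hu0, mul_div_cancel₀ _ hr0.ne', Real.rpow_two] at h2
    refine le_trans ?_ h2
    calc (β * s) ^ 2 / 4 * (2 * h) ^ 2 = (β * h * s) ^ 2 := by ring
      _ ≤ u ^ 2 := by gcongr
  refine le_min (h1.trans ?_) (h1.trans ?_)
  · have h2 : M ^ (2 / r) ≤ M := by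
      simpa using Real.rpow_le_rpow_of_exponent_le hM h2r
    calc M ^ (2 / r) / (2 * h) ^ 2 ≤ M / (2 * h) ^ 2 := by gcongr
      _ = _ := by field_simp
  · rw [Real.div_rpow hM0.le (by positivity)]
    have h3 : (2 * h) ^ (2 / r) ≤ (2 * h) ^ 2 := by
      rw [← Real.rpow_two]
      exact Real.rpow_le_rpow_of_exponent_le (by linarith) (by linarith)
    gcongr

/-- The difference of powers is at most `p |U - V| max(|U|, |V|)^(p-1)`: one factor of size `d` and
a power `p - 1` of size `H`. This keeps the bound linear in the increment. -/
lemma lintegral_exp_abs_rpow_sub_le [IsProbabilityMeasure μ] {U V : Ω → ℝ} {p d H : ℝ}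
    (hp : 1 ≤ p) (hd : 0 < d) (hH0 : 0 < H) (hU : Measurable U) (hV : Measurable V)
    (hUV : ∫⁻ ω, ENNReal.ofReal (Real.exp ((U ω - V ω) ^ 2 / d ^ 2)) ∂μ ≤ 2)
    (hUe : ∫⁻ ω, ENNReal.ofReal (Real.exp (U ω ^ 2 / H ^ 2)) ∂μ ≤ 2)
    (hVe : ∫⁻ ω, ENNReal.ofReal (Real.exp (V ω ^ 2 / H ^ 2)) ∂μ ≤ 2) :
    ∫⁻ ω, ENNReal.ofReal (Real.exp
      (|(|U ω| ^ p - |V ω| ^ p) / (p * d * H ^ (p - 1))| ^ (2 / max p 2))) ∂μ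
      ≤ ENNReal.ofReal 9 := by
  refine lintegral_exp_abs_le_nine (f := fun ω => (U ω - V ω) / d)
    (g := fun ω => U ω / H) (h := fun ω => V ω / H) hp
    ((hU.sub hV).div_const _) (hU.div_const _) (fun ω => ?_)
    (by simpa only [div_pow] using hUV) (by simpa only [div_pow] using hUe)
    (by simpa only [div_pow] using hVe)
  set w := max 1 (max |(U ω - V ω) / d| (max |U ω / H| |V ω / H|)) with hw
  have hw1 : 1 ≤ w := le_max_left _ _
  have hwg : |U ω - V ω| / d ≤ w := by
    refine le_trans (le_of_eq ?_) ((le_max_left _ _).trans (le_max_right _ _))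
    rw [abs_div, abs_of_pos (by positivity : 0 < d)]
  have hwm : max |U ω| |V ω| / H ≤ w := by
    refine le_trans (le_of_eq ?_) ((le_max_right _ _).trans (le_max_right _ _))
    rw [abs_div, abs_div, abs_of_pos hH0, max_div_div_right hH0.le]
  rw [abs_div, abs_of_pos (by positivity : 0 < p * d * H ^ (p - 1))]
  calc |(|U ω| ^ p - |V ω| ^ p)| / (p * d * H ^ (p - 1))
      ≤ p * |U ω - V ω| * max |U ω| |V ω| ^ (p - 1) / (p * d * H ^ (p - 1)) := by
        gcongr; exact abs_abs_rpow_sub_abs_rpow_le hp _ _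
    _ = |U ω - V ω| / d * (max |U ω| |V ω| / H) ^ (p - 1) := by
        rw [Real.div_rpow (by positivity) hH0.le]; field_simp
    _ ≤ w * w ^ (p - 1) := by
        have : 0 ≤ max |U ω| |V ω| / H := by positivity
        gcongr
    _ = w ^ p := by
        rw [mul_comm, ← Real.rpow_add_one (by linarith)]; simp

lemma lintegral_exp_abs_one_sub_rpow_le [IsProbabilityMeasure μ] {U : Ω → ℝ} {p H : ℝ}
    (hp : 1 ≤ p) (hH : 1 ≤ H) (hU : Measurable U)
    (hUe : ∫⁻ ω, ENNReal.ofReal (Real.exp (U ω ^ 2 / H ^ 2)) ∂μ ≤ 2) :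
    ∫⁻ ω, ENNReal.ofReal (Real.exp (|(1 - |U ω| ^ p) / H ^ p| ^ (2 / max p 2))) ∂μ
      ≤ ENNReal.ofReal 9 := by
  have hp0 : 0 < p := by linarith
  have hH0 : 0 < H := by linarith
  have hHp : 1 ≤ H ^ p := Real.one_le_rpow hH hp0.le
  refine lintegral_exp_abs_le_nine (f := fun ω => U ω / H)
    (g := fun ω => U ω / H) (h := fun ω => U ω / H) hp
    (hU.div_const _) (hU.div_const _) (fun ω => ?_)
    (by simpa only [div_pow] using hUe) (by simpa only [div_pow] using hUe)
    (by simpa only [div_pow] using hUe)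
  rw [max_self, max_self]
  set w := max 1 |U ω / H| with hw
  have hw1 : 1 ≤ w := le_max_left _ _
  have hwp : 1 ≤ w ^ p := Real.one_le_rpow hw1 hp0.le
  have hwU : |U ω| ^ p / H ^ p ≤ w ^ p := by
    rw [← Real.div_rpow (abs_nonneg _) hH0.le]
    refine Real.rpow_le_rpow (by positivity) (le_trans (le_of_eq ?_) (le_max_right _ _))
      hp0.le
    rw [abs_div, abs_of_pos hH0]
  have hU0 : 0 ≤ |U ω| ^ p / H ^ p := by positivity
  have hH1 : 1 / H ^ p ≤ 1 := (div_le_one (by positivity)).2 hHp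
  have hH2 : 0 ≤ 1 / H ^ p := by positivity
  rw [sub_div, abs_le]
  constructor <;> linarith

/-- Linearises the `p`-th root at `S`, with `S^(1 - 1/p) ≥ (M/2)^(1 - 1/p) ≥ M^(1 - 1/p) / 2`. -/
lemma half_rpow_mul_abs_sub_le {p M S T : ℝ} (hp : 1 ≤ p) (hM : 0 ≤ M) (hS : M / 2 ≤ S)
    (hT : 0 ≤ T) : M ^ (1 - 1 / p) / 2 * |S ^ (1 / p) - T ^ (1 / p)| ≤ |S - T| := by
  have hp0 : 0 < p := by linarith
  have hS0 : 0 ≤ S := by linarith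
  have h1 := rpow_mul_abs_sub_le hp (Real.rpow_nonneg hS0 (1 / p)) (Real.rpow_nonneg hT (1 / p))
  rw [← Real.rpow_mul hS0, ← Real.rpow_mul hS0, ← Real.rpow_mul hT,
    one_div_mul_cancel hp0.ne', Real.rpow_one, Real.rpow_one] at h1
  refine le_trans ?_ h1
  have e1 : 1 / p * (p - 1) = 1 - 1 / p := by field_simp
  have h0 : 0 ≤ 1 - 1 / p := by
    rw [sub_nonneg]; exact (div_le_one hp0).2 hp
  rw [e1]
  gcongr
  calc M ^ (1 - 1 / p) / 2 ≤ M ^ (1 - 1 / p) / 2 ^ (1 - 1 / p) := by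
        gcongr
        have : 0 ≤ 1 / p := by positivity
        simpa using Real.rpow_le_rpow_of_exponent_le (x := 2) one_le_two
          (by linarith : 1 - 1 / p ≤ 1)
    _ = (M / 2) ^ (1 - 1 / p) := (Real.div_rpow hM two_pos.le _).symm
    _ ≤ _ := Real.rpow_le_rpow (by positivity) hS h0

/-- The Bochner integral of a non-integrable function is `0` by convention, so the normalisation
itself supplies integrability. -/
lemma integrable_of_integral_eq_one {f : Ω → ℝ} (h : ∫ ω, f ω ∂μ = 1) : Integrable f μ := by
  by_contra hn
  rw [integral_undef hn] at h
  exact zero_ne_one h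

set_option maxHeartbeats 400000 in
/-- Sub-Gaussian tail of the difference of the `ℓ_p` norms of two random vectors with
independent sub-Gaussian coordinates having the same `p`-th absolute moment. -/
theorem exists_measure_abs_norm_sub_ge_le {p : ℝ} (hp : 1 ≤ p) :
    ∃ C b : ℝ, 1 ≤ C ∧ 0 < b ∧ ∀ {Ω : Type*} [MeasurableSpace Ω] (μ : Measure Ω)
      [IsProbabilityMeasure μ] (m : ℕ) (U V : Fin m → Ω → ℝ) (κ H δ : ℝ),
      0 < m → 0 < κ → 1 ≤ H → 0 < δ → (∀ i, Measurable (U i)) → (∀ i, Measurable (V i)) →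
      (∀ φ : ℝ → ℝ → ℝ, Measurable (Function.uncurry φ) →
        iIndepFun (fun i ω => φ (U i ω) (V i ω)) μ) →
      (∀ i, ∫⁻ ω, ENNReal.ofReal (Real.exp ((U i ω - V i ω) ^ 2 / (κ * δ) ^ 2)) ∂μ ≤ 2) →
      (∀ i, ∫⁻ ω, ENNReal.ofReal (Real.exp (U i ω ^ 2 / H ^ 2)) ∂μ ≤ 2) →
      (∀ i, ∫⁻ ω, ENNReal.ofReal (Real.exp (V i ω ^ 2 / H ^ 2)) ∂μ ≤ 2) →
      (∀ i, ∫ ω, |U i ω| ^ p ∂μ = 1) → (∀ i, ∫ ω, |V i ω| ^ p ∂μ = 1) →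
      ∀ s : ℝ, 0 ≤ s →
      μ {ω | b * κ * H ^ p * (m : ℝ) ^ (1 / p - 1 / max p 2) * δ * s
          ≤ |(∑ i, |U i ω| ^ p) ^ (1 / p) - (∑ i, |V i ω| ^ p) ^ (1 / p)|}
        ≤ ENNReal.ofReal (C * Real.exp (-s ^ 2)) := by
  have hp0 : 0 < p := by linarith
  set r := max p 2 with hrdef
  have hr : 2 ≤ r := le_max_right _ _
  have hpr : p ≤ r := le_max_left _ _
  have hr0 : 0 < r := by linarith
  obtain ⟨C₁, c₁, b₁, hC₁, hc₁, hb₁, H₁⟩ := exists_measure_sum_rpow_ge_le hr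
  obtain ⟨C₂, c₂, hC₂, hc₂, H₂⟩ := exists_measure_abs_sum_ge_le (α := 2 / r) (G := 9)
    (by positivity) ((div_le_one hr0).2 hr) (by norm_num)
  -- Chosen so that `c₁ β² ≥ 1` and `c₂ β² ≥ 4`; the `4` pays for the loss in
  -- `sq_div_four_le_min_of_le`.
  set β := 1 + 4 / c₂ + 1 / c₁ with hβdef
  have hβ1 : 1 ≤ β := by
    have : 0 ≤ 4 / c₂ := by positivity
    have : 0 ≤ 1 / c₁ := by positivity
    linarith
  have hβc₁ : 1 ≤ c₁ * β ^ 2 := by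
    have h1 : 1 / c₁ ≤ β := by
      have : 0 ≤ 4 / c₂ := by positivity
      linarith
    rw [div_le_iff₀ hc₁] at h1
    nlinarith
  have hβc₂ : 4 ≤ c₂ * β ^ 2 := by
    have h1 : 4 / c₂ ≤ β := by
      have : 0 ≤ 1 / c₁ := by positivity
      linarith
    rw [div_le_iff₀ hc₂] at h1
    nlinarith
  refine ⟨C₁ + (C₂ + C₂), 2 * p * b₁ * β, by linarith, by positivity, ?_⟩
  intro Ω _ μ _ m U V κ H δ hm hκ hH hδ hU hV hind hUV hUe hVe hUm hVm s hs
  have hm1 : (1 : ℝ) ≤ m := Nat.one_le_cast.2 hm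
  have hm0 : (0 : ℝ) < m := by linarith
  have hH0 : 0 < H := by linarith
  have hHp : 1 ≤ H ^ p := Real.one_le_rpow hH hp0.le
  set u := 2 * p * β * H ^ p * s with hu
  have hu0 : 0 ≤ u := by positivity
  have huβ : β * H ^ p * s ≤ u := by
    have : 0 ≤ β * H ^ p * s := by positivity
    rw [hu]; nlinarith
  have huβ' : β * s ≤ u := by
    refine le_trans ?_ huβ
    have : 0 ≤ β * s := by positivity
    nlinarith
  rcases le_or_gt (m : ℝ) (u ^ r) with hmu | hmu
  · -- large deviations: compare with the norm of the difference
    have h1 := H₁ μ m (fun i ω => U i ω - V i ω) (κ * δ) hm (by positivity)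
      (fun i => (hU i).sub (hV i)) (hind (fun a b => a - b) measurable_sub) hUV u hu0 hmu
    refine (measure_mono fun ω hω => ?_).trans (h1.trans (ENNReal.ofReal_le_ofReal ?_))
    · simp only [Set.mem_ofPred_eq] at hω ⊢
      have h2 := hω.trans ((abs_sum_rpow_rpow_sub_le hp _ _).trans (sum_rpow_rpow_le hp hpr _))
      have hρ : 0 < (m : ℝ) ^ (1 / p - 1 / r) := by positivity
      refine le_of_mul_le_mul_left (le_trans (le_of_eq ?_) h2) hρ
      rw [hu]; ring
    · have h3 : s ^ 2 ≤ c₁ * u ^ 2 := by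
        calc s ^ 2 ≤ c₁ * β ^ 2 * s ^ 2 := le_mul_of_one_le_left (sq_nonneg s) hβc₁
          _ = c₁ * (β * s) ^ 2 := by ring
          _ ≤ _ := by gcongr
      calc C₁ * Real.exp (-(c₁ * u ^ 2)) ≤ C₁ * Real.exp (-s ^ 2) := by gcongr
        _ ≤ _ := by gcongr; linarith
  -- Moderate deviations: either the power sum of `U` is at most `m/2`, or the root can be
  -- linearised and the centred sum of `|U i|^p - |V i|^p`, scaled by `L`, must be at least `t`.
  · set L := p * (κ * δ) * H ^ (p - 1) with hL
    have hL0 : 0 < L := by positivity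
    set t := β * s * (m : ℝ) ^ (1 - 1 / r) with ht
    have ht0 : 0 ≤ t := by positivity
    have hDm : Measurable (Function.uncurry fun a b : ℝ => (|a| ^ p - |b| ^ p) / L) := by
      unfold Function.uncurry; fun_prop
    have hEm : Measurable (Function.uncurry fun a _b : ℝ => (1 - |a| ^ p) / H ^ p) := by
      unfold Function.uncurry; fun_prop
    have hUi := fun i => integrable_of_integral_eq_one (hUm i)
    have hVi := fun i => integrable_of_integral_eq_one (hVm i)
    have hD := H₂ μ m (fun i ω => (|U i ω| ^ p - |V i ω| ^ p) / L) hm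
      (fun i => hDm.comp ((hU i).prodMk (hV i))) (hind _ hDm)
      (fun i => lintegral_exp_abs_rpow_sub_le hp (by positivity) hH0 (hU i) (hV i) (hUV i)
        (hUe i) (hVe i))
      (fun i => by
        rw [integral_div, integral_sub (hUi i) (hVi i), hUm, hVm, sub_self, zero_div]) t ht0
    have hE := H₂ μ m (fun i ω => (1 - |U i ω| ^ p) / H ^ p) hm
      (fun i => hEm.comp ((hU i).prodMk (hV i))) (hind _ hEm)
      (fun i => lintegral_exp_abs_one_sub_rpow_le hp hH (hU i) (hUe i))
      (fun i => by
        rw [integral_div, integral_sub (integrable_const _) (hUi i), hUm]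
        simp) (m / (2 * H ^ p)) (by positivity)
    have hρ : (m : ℝ) ^ (1 / p - 1 / r) * (m : ℝ) ^ (1 - 1 / p) = (m : ℝ) ^ (1 - 1 / r) := by
      rw [← Real.rpow_add hm0]; congr 1; ring
    have hsub : {ω | 2 * p * b₁ * β * κ * H ^ p * (m : ℝ) ^ (1 / p - 1 / r) * δ * s
          ≤ |(∑ i, |U i ω| ^ p) ^ (1 / p) - (∑ i, |V i ω| ^ p) ^ (1 / p)|}
        ⊆ {ω | t ≤ |∑ i, (|U i ω| ^ p - |V i ω| ^ p) / L|}
          ∪ {ω | m / (2 * H ^ p) ≤ |∑ i, (1 - |U i ω| ^ p) / H ^ p|} := by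
      intro ω hω
      simp only [Set.mem_union, Set.mem_ofPred_eq] at hω ⊢
      set S := ∑ i, |U i ω| ^ p with hS
      set T := ∑ i, |V i ω| ^ p with hT
      have hS0 : 0 ≤ S := Finset.sum_nonneg fun i _ => by positivity
      have hT0 : 0 ≤ T := Finset.sum_nonneg fun i _ => by positivity
      rw [← Finset.sum_div, ← Finset.sum_div, Finset.sum_sub_distrib, Finset.sum_sub_distrib,
        ← hS, ← hT]
      simp only [Finset.sum_const, Finset.card_univ, Fintype.card_fin, nsmul_eq_mul, mul_one]
      rcases le_or_gt S (m / 2) with hSm | hSm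
      · right
        refine le_trans ?_ (le_abs_self _)
        rw [← div_div]
        gcongr
        linarith
      · left
        rw [abs_div, abs_of_pos hL0, le_div_iff₀ hL0]
        refine le_trans ?_ (half_rpow_mul_abs_sub_le hp hm0.le hSm.le hT0)
        have h3 : H ^ (p - 1) ≤ H ^ p := Real.rpow_le_rpow_of_exponent_le hH (by linarith)
        calc t * L = (m : ℝ) ^ (1 - 1 / r) * (p * β * κ * δ * s) * H ^ (p - 1) := by
              rw [ht, hL]; ring
          _ ≤ (m : ℝ) ^ (1 - 1 / r) * (p * β * κ * δ * s) * H ^ p := by gcongr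
          _ ≤ (m : ℝ) ^ (1 - 1 / r) * (p * β * κ * δ * s) * H ^ p * b₁ :=
              le_mul_of_one_le_right (by positivity) hb₁
          _ = (m : ℝ) ^ (1 - 1 / p) / 2
              * (2 * p * b₁ * β * κ * H ^ p * (m : ℝ) ^ (1 / p - 1 / r) * δ * s) := by
              rw [← hρ]; ring
          _ ≤ _ := by gcongr
    refine (measure_mono hsub).trans ((measure_union_le _ _).trans
      ((add_le_add hD hE).trans ?_))
    rw [← ENNReal.ofReal_add (by positivity) (by positivity)]
    refine ENNReal.ofReal_le_ofReal ?_
    have m1 := sq_le_min_of_le hr hm1 (by linarith) hs huβ' hmu.le ht.ge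
    have m2 := sq_div_four_le_min_of_le hr hm1 hHp (by linarith) hs huβ hmu.le
    have h1 : s ^ 2 ≤ c₂ * min (t ^ 2 / m) (t ^ (2 / r)) := by
      calc s ^ 2 ≤ c₂ * β ^ 2 * s ^ 2 := le_mul_of_one_le_left (sq_nonneg s) (by linarith)
        _ = c₂ * (β * s) ^ 2 := by ring
        _ ≤ _ := by gcongr
    have h2 : s ^ 2 ≤ c₂ * min ((m / (2 * H ^ p)) ^ 2 / m) ((m / (2 * H ^ p)) ^ (2 / r)) := by
      calc s ^ 2 ≤ c₂ * β ^ 2 / 4 * s ^ 2 := le_mul_of_one_le_left (sq_nonneg s) (by linarith)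
        _ = c₂ * ((β * s) ^ 2 / 4) := by ring
        _ ≤ _ := by gcongr
    calc _ ≤ C₂ * Real.exp (-s ^ 2) + C₂ * Real.exp (-s ^ 2) := by gcongr
      _ ≤ _ := by
        rw [← add_mul]
        exact mul_le_mul_of_nonneg_right (by linarith) (Real.exp_pos _).le

end Increment

/-! ### The power of `m` against the Euclidean radius of the dual ball. -/

section Radius

lemma ellNorm_eq_sum {m : ℕ} {p : ℝ} (hp : 0 < p) (z : Fin m → ℝ) :
    ellNorm (ENNReal.ofReal p) z = (∑ i, |z i| ^ p) ^ (1 / p) := by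
  have h : (ENNReal.ofReal p).toReal = p := ENNReal.toReal_ofReal hp.le
  rw [ellNorm, PiLp.norm_eq_sum (by rw [h]; exact hp), h]
  simp only [Real.norm_eq_abs]

lemma norm_le_rad {m : ℕ} {q : ℝ≥0∞} (hq : 1 ≤ q) {z : EuclideanSpace ℝ (Fin m)}
    (hz : z ∈ ellBall q m) : ‖z‖ ≤ rad (ellBall q m) := by
  have : Fact (1 ≤ q) := ⟨hq⟩
  refine le_csSup ⟨Real.sqrt m, ?_⟩ ⟨z, hz, rfl⟩
  rintro _ ⟨y, hy, rfl⟩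
  refine Real.le_sqrt_of_sq_le ?_
  rw [EuclideanSpace.real_norm_sq_eq]
  calc ∑ i, y i ^ 2 ≤ ∑ _i : Fin m, (1 : ℝ) := by
        refine Finset.sum_le_sum fun i _ => ?_
        have h1 : ‖y i‖ ≤ 1 :=
          (PiLp.norm_apply_le (WithLp.toLp q y.ofLp : PiLp q fun _ : Fin m => ℝ) i).trans hy
        rw [← sq_abs]
        exact pow_le_one₀ (abs_nonneg _) h1
    _ = m := by simp

/-- Explicit points of the ball give the lower bound: a coordinate vector when `p ≥ 2`, the constant
vector `m^(-1/q)` when `p ≤ 2`. -/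
lemma rpow_le_rad_ellBall {m : ℕ} [NeZero m] {p : ℝ} (hp : 1 ≤ p) {q : ℝ≥0∞}
    (hpq : ENNReal.HolderConjugate (ENNReal.ofReal p) q) :
    (m : ℝ) ^ (1 / p - 1 / max p 2) ≤ rad (ellBall q m) := by
  have hp0 : 0 < p := by linarith
  have hq : 1 ≤ q := ENNReal.HolderConjugate.one_le q (ENNReal.ofReal p)
  have : Fact (1 ≤ q) := ⟨hq⟩
  have hm0 : (0 : ℝ) < m := Nat.cast_pos.2 (NeZero.pos m)
  rcases le_total 2 p with h2 | h2
  · rw [max_eq_left h2, sub_self, Real.rpow_zero]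
    have hz : PiLp.single 2 (0 : Fin m) (1 : ℝ) ∈ ellBall q m := by
      show ‖(WithLp.toLp q (PiLp.single 2 (0 : Fin m) (1 : ℝ)).ofLp : PiLp q fun _ : Fin m => ℝ)‖
        ≤ 1
      rw [PiLp.ofLp_single, PiLp.toLp_single, PiLp.norm_single, norm_one]
    have := norm_le_rad hq hz
    rwa [PiLp.norm_single, norm_one] at this
  · rw [max_eq_right h2]
    have hconj := ENNReal.holderConjugate_iff.1 hpq
    set c : ℝ := (m : ℝ) ^ (-(1 - 1 / p)) with hc
    have hc0 : 0 < c := by positivity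
    have hqinv : q⁻¹.toReal = 1 - 1 / p := by
      have h1 := congrArg ENNReal.toReal hconj
      have hqt : q⁻¹ ≠ ∞ := ENNReal.inv_ne_top.2 (zero_lt_one.trans_le hq).ne'
      have hpt : (ENNReal.ofReal p)⁻¹ ≠ ∞ := ENNReal.inv_ne_top.2 (by simpa using hp0)
      rw [ENNReal.toReal_add hpt hqt, ENNReal.toReal_inv, ENNReal.toReal_ofReal hp0.le,
        ENNReal.toReal_one] at h1
      rw [one_div]; linarith
    have hz : WithLp.toLp 2 (fun _ : Fin m => c) ∈ ellBall q m := by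
      show ‖(WithLp.toLp q (Function.const (Fin m) c) : PiLp q fun _ : Fin m => ℝ)‖ ≤ 1
      have e : (1 / q).toReal = 1 - 1 / p := by rw [one_div, hqinv]
      rw [PiLp.norm_toLp_const']
      simp only [NNReal.coe_natCast, Fintype.card_fin]
      rw [e, Real.norm_eq_abs, abs_of_pos hc0, hc, ← Real.rpow_add hm0]
      simp
    refine le_trans (le_of_eq ?_) (norm_le_rad hq hz)
    rw [EuclideanSpace.norm_eq]
    simp only [Finset.sum_const, Finset.card_univ, Fintype.card_fin, nsmul_eq_mul,
      Real.norm_eq_abs, sq_abs]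
    rw [Real.sqrt_mul hm0.le, Real.sqrt_sq hc0.le, Real.sqrt_eq_rpow, hc, ← Real.rpow_add hm0]
    congr 1; ring

end Radius

/-! ### From exponential moments to the Orlicz norm, and the cost of centring. -/

section Orlicz

variable {Ω : Type*} [MeasurableSpace Ω] {μ : Measure Ω}

lemma orliczNorm_two_le {Z : Ω → ℝ} {b : ℝ} (hb : 0 < b)
    (h : ∫⁻ ω, ENNReal.ofReal (Real.exp (Z ω ^ 2 / b ^ 2)) ∂μ ≤ 2) :
    orliczNorm 2 Z μ ≤ ENNReal.ofReal b :=
  sInf_le ⟨b, ⟨hb, by simpa only [Real.rpow_two, sq_abs] using h⟩, rfl⟩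

lemma orliczNorm_two_zero [IsProbabilityMeasure μ] : orliczNorm 2 (fun _ : Ω => (0 : ℝ)) μ = 0 := by
  refine le_antisymm (ENNReal.le_of_forall_pos_le_add fun ε hε _ => ?_) bot_le
  rw [zero_add, ← ENNReal.ofReal_coe_nnreal]
  exact orliczNorm_two_le (by exact_mod_cast hε) (by simp)

/-- The mean is at most `T` in absolute value, so `(Z - 𝔼Z)² ≤ 2Z² + 2T²`; dividing by `16 T²` and
applying Jensen with exponent `1/8` leaves `(2e)^(1/8) ≤ 2`. -/
lemma lintegral_exp_sub_integral_sq_le [IsProbabilityMeasure μ] {Z : Ω → ℝ} (hZ : Measurable Z)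
    {T : ℝ} (hT : 0 < T) (h : ∫⁻ ω, ENNReal.ofReal (Real.exp (Z ω ^ 2 / T ^ 2)) ∂μ ≤ 2) :
    ∫⁻ ω, ENNReal.ofReal (Real.exp ((Z ω - ∫ ω', Z ω' ∂μ) ^ 2 / (4 * T) ^ 2)) ∂μ ≤ 2 := by
  have h' : ∫⁻ ω, ENNReal.ofReal (Real.exp (Z ω ^ 2 / T ^ 2)) ∂μ ≤ ENNReal.ofReal 2 := by
    simpa using h
  have hE := integral_le_of_lintegral_ofReal_le (by fun_prop) (fun ω => (Real.exp_pos _).le)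
    (by norm_num) h'
  have hEi := integrable_of_lintegral_ofReal_le (by fun_prop) (fun ω => (Real.exp_pos _).le) h'
  set a := ∫ ω', Z ω' ∂μ with ha
  have ha2 : a ^ 2 ≤ T ^ 2 := by
    rw [← sq_abs]
    refine pow_le_pow_left₀ (abs_nonneg _) ?_ 2
    calc |a| = ‖∫ ω, Z ω ∂μ‖ := rfl
      _ ≤ ∫ ω, T / 2 * Real.exp (Z ω ^ 2 / T ^ 2) ∂μ := by
          refine norm_integral_le_of_norm_le (hEi.const_mul _) (ae_of_all _ fun ω => ?_)
          have h1 := Real.add_one_le_exp (Z ω ^ 2 / T ^ 2)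
          have h2 : |Z ω| ≤ T / 2 * (Z ω ^ 2 / T ^ 2 + 1) := by
            have e : T / 2 * (Z ω ^ 2 / T ^ 2 + 1) = (|Z ω| ^ 2 + T ^ 2) / (2 * T) := by
              rw [sq_abs]; field_simp
            rw [e, le_div_iff₀ (by positivity)]
            nlinarith [sq_nonneg (|Z ω| - T)]
          exact h2.trans (mul_le_mul_of_nonneg_left h1 (by positivity))
      _ ≤ T := by rw [integral_const_mul]; nlinarith
  have h8 := lintegral_exp_mul_le (θ := 1 / 8) (by fun_prop) (by norm_num) h' (by norm_num)
    (by norm_num)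
  calc ∫⁻ ω, ENNReal.ofReal (Real.exp ((Z ω - a) ^ 2 / (4 * T) ^ 2)) ∂μ
      ≤ ∫⁻ ω, ENNReal.ofReal (Real.exp (1 / 8))
          * ENNReal.ofReal (Real.exp (1 / 8 * (Z ω ^ 2 / T ^ 2))) ∂μ := by
        refine lintegral_mono fun ω => ?_
        rw [← ENNReal.ofReal_mul (Real.exp_pos _).le, ← Real.exp_add]
        refine ENNReal.ofReal_le_ofReal (Real.exp_le_exp.2 ?_)
        have e : 1 / 8 + 1 / 8 * (Z ω ^ 2 / T ^ 2) = (2 * T ^ 2 + 2 * Z ω ^ 2) / (4 * T) ^ 2 := by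
          field_simp; norm_num
        rw [e]
        gcongr
        nlinarith [sq_nonneg (Z ω + a)]
    _ = ENNReal.ofReal (Real.exp (1 / 8))
          * ∫⁻ ω, ENNReal.ofReal (Real.exp (1 / 8 * (Z ω ^ 2 / T ^ 2))) ∂μ :=
        lintegral_const_mul _ (by fun_prop)
    _ ≤ ENNReal.ofReal (Real.exp (1 / 8)) * ENNReal.ofReal (2 ^ (1 / 8 : ℝ)) := by gcongr
    _ = ENNReal.ofReal (Real.exp (1 / 8) * 2 ^ (1 / 8 : ℝ)) :=
        (ENNReal.ofReal_mul (Real.exp_pos _).le).symm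
    _ ≤ ENNReal.ofReal 2 := by
        refine ENNReal.ofReal_le_ofReal ?_
        have e1 : Real.exp (1 / 8) = Real.exp 1 ^ (1 / 8 : ℝ) := by rw [← Real.exp_mul]; norm_num
        rw [e1, ← Real.mul_rpow (Real.exp_pos _).le (by norm_num)]
        calc (Real.exp 1 * 2) ^ (1 / 8 : ℝ) ≤ (2 ^ (8 : ℝ)) ^ (1 / 8 : ℝ) := by
              gcongr
              have := Real.exp_one_lt_d9
              norm_num
              linarith
          _ = 2 := by rw [← Real.rpow_mul (by norm_num)]; norm_num
    _ = 2 := by simp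

end Orlicz

/-! ### The increment bound for `‖Ax‖_p`. -/

section Processes

lemma ellNorm_mulVec_eq {Ω : Type*} {m n : ℕ} {A : Ω → Matrix (Fin m) (Fin n) ℝ} {p : ℝ} (hp : 0 < p) (x : EuclideanSpace ℝ (Fin n)) (ω : Ω) :
    ellNorm (ENNReal.ofReal p) ((A ω).mulVec x.ofLp)
      = (∑ i, |rowForm A x i ω| ^ p) ^ (1 / p) :=
  ellNorm_eq_sum hp _

variable {Ω : Type*} [MeasurableSpace Ω] {μ : Measure Ω}
  {m n : ℕ} [NeZero m] [NeZero n] {A : Ω → Matrix (Fin m) (Fin n) ℝ}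

lemma measurable_ellNorm_mulVec (hA : IsIIDSubGaussianMatrix A μ) {p : ℝ} (hp : 0 < p)
    (x : EuclideanSpace ℝ (Fin n)) :
    Measurable fun ω => ellNorm (ENNReal.ofReal p) ((A ω).mulVec x.ofLp) := by
  simp only [ellNorm_mulVec_eq hp]
  have := measurable_rowForm hA x
  fun_prop

lemma integrable_ellNorm_mulVec [IsProbabilityMeasure μ] (hA : IsIIDSubGaussianMatrix A μ) {p : ℝ} (hp : 1 ≤ p)
    {x : EuclideanSpace ℝ (Fin n)} (hx : x ∈ rowSphere p A μ) :
    Integrable (fun ω => ellNorm (ENNReal.ofReal p) ((A ω).mulVec x.ofLp)) μ := by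
  have hp0 : 0 < p := by linarith
  have hi : Integrable (fun ω => 1 + ∑ i, |rowForm A x i ω| ^ p) μ :=
    (integrable_const _).add (integrable_finsetSum _ fun i _ =>
      integrable_of_integral_eq_one (integral_abs_rowForm_rpow hA hp hx i))
  refine hi.mono' (measurable_ellNorm_mulVec hA hp0 x).aestronglyMeasurable
    (ae_of_all _ fun ω => ?_)
  rw [ellNorm_mulVec_eq hp0]
  have hS : 0 ≤ ∑ i, |rowForm A x i ω| ^ p := Finset.sum_nonneg fun i _ => by positivity
  rw [Real.norm_eq_abs, abs_of_nonneg (by positivity)]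
  have h1p : 1 / p ≤ 1 := (div_le_one hp0).2 hp
  rcases le_total (∑ i, |rowForm A x i ω| ^ p) 1 with h | h
  · have := Real.rpow_le_one hS h (by positivity : 0 ≤ 1 / p)
    linarith
  · have := Real.rpow_le_rpow_of_exponent_le h h1p
    rw [Real.rpow_one] at this
    linarith

/-- The `ψ₂` bound for the increments of `‖A x‖_p`. -/
theorem exists_lintegral_exp_increment_sq_le {p : ℝ} (hp : 1 ≤ p) :
    ∃ C : ℝ, 0 < C ∧ ∀ {Ω : Type*} [MeasurableSpace Ω] (μ : Measure Ω) [IsProbabilityMeasure μ]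
      (m n : ℕ) [NeZero m] [NeZero n] (A : Ω → Matrix (Fin m) (Fin n) ℝ),
      IsIIDSubGaussianMatrix A μ → ∀ x ∈ rowSphere p A μ, ∀ y ∈ rowSphere p A μ, x ≠ y →
      ∃ T : ℝ, 0 < T ∧
        T ≤ C * entryNorm A μ ^ (4 * p) * (m : ℝ) ^ (1 / p - 1 / max p 2) * ‖x - y‖ ∧
        ∫⁻ ω, ENNReal.ofReal (Real.exp
          ((ellNorm (ENNReal.ofReal p) ((A ω).mulVec x.ofLp)
            - ellNorm (ENNReal.ofReal p) ((A ω).mulVec y.ofLp)) ^ 2 / T ^ 2)) ∂μ ≤ 2 := by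
  have hp0 : 0 < p := by linarith
  obtain ⟨C, b, hC, hb, H⟩ := exists_measure_abs_norm_sub_ge_le hp
  -- `√(2C)` is the price of turning the tail into a `ψ₂` bound, `4` comes from `κ = 4t`, `704 = 4 ·
  -- 176` from `H = 704 t³`, and `2^(4p)` from `t ≤ 2K`.
  refine ⟨Real.sqrt (2 * C) * b * 4 * 704 ^ p * 2 ^ (4 * p), by positivity, ?_⟩
  intro Ω _ μ _ m n _ _ A hA x hx y hy hxy
  obtain ⟨t, ht1, htK, ht⟩ := exists_entry_parameter hA
  have ht0 : 0 < t := by linarith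
  have hK0 : 0 < entryNorm A μ := by linarith
  have hδ : 0 < ‖x - y‖ := norm_pos_iff.2 (sub_ne_zero.2 hxy)
  have hm : 0 < m := NeZero.pos m
  have hm0 : (0 : ℝ) < m := Nat.cast_pos.2 hm
  have hform : ∀ z ∈ rowSphere p A μ, ∀ i,
      ∫⁻ ω, ENNReal.ofReal (Real.exp (rowForm A z i ω ^ 2 / (704 * t ^ 3) ^ 2)) ∂μ ≤ 2 := by
    intro z hz i
    have := lintegral_exp_rowForm_sq_le hA ht0 ht z (d := 176 * t ^ 2) (by positivity)
      (norm_le_of_mem_rowSphere hA ht0 ht hp hz) i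
    rwa [show 4 * t * (176 * t ^ 2) = 704 * t ^ 3 by ring] at this
  have htail := H μ m (rowForm A x) (rowForm A y) (4 * t) (704 * t ^ 3) ‖x - y‖ hm
    (by positivity) (by nlinarith [one_le_pow₀ ht1 (n := 3)]) hδ (measurable_rowForm hA x)
    (measurable_rowForm hA y) (fun φ hφ => iIndepFun_rowForm_comp hA x y hφ)
    (fun i => by
      simpa only [rowForm_sub] using lintegral_exp_rowForm_sq_le hA ht0 ht (x - y) hδ le_rfl i)
    (hform x hx) (hform y hy) (integral_abs_rowForm_rpow hA hp hx)
    (integral_abs_rowForm_rpow hA hp hy)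
  set B := b * (4 * t) * (704 * t ^ 3) ^ p * (m : ℝ) ^ (1 / p - 1 / max p 2) * ‖x - y‖ with hB
  have hB0 : 0 < B := by positivity
  have key := lintegral_exp_sq_le_of_tail (μ := μ)
    (Z := fun ω => ellNorm (ENNReal.ofReal p) ((A ω).mulVec x.ofLp)
      - ellNorm (ENNReal.ofReal p) ((A ω).mulVec y.ofLp))
    ((measurable_ellNorm_mulVec hA hp0 x).sub (measurable_ellNorm_mulVec hA hp0 y))
    hB0 hC fun s hs => by
      simp only [ellNorm_mulVec_eq hp0]
      exact htail s hs
  refine ⟨Real.sqrt (2 * C) * B, by positivity, ?_, ?_⟩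
  · have h1 : t * (704 * t ^ 3) ^ p ≤ 704 ^ p * (2 ^ (4 * p) * entryNorm A μ ^ (4 * p)) := by
      rw [Real.mul_rpow (by norm_num) (by positivity), ← Real.mul_rpow (by norm_num) hK0.le,
        mul_left_comm]
      refine mul_le_mul_of_nonneg_left ?_ (by positivity)
      calc t * (t ^ 3) ^ p = t ^ (3 * p + 1) := by
            rw [Real.rpow_add_one ht0.ne', ← Real.rpow_natCast, ← Real.rpow_mul ht0.le]
            push_cast; ring
        _ ≤ t ^ (4 * p) := Real.rpow_le_rpow_of_exponent_le ht1 (by linarith)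
        _ ≤ _ := Real.rpow_le_rpow ht0.le htK (by positivity)
    calc Real.sqrt (2 * C) * B = Real.sqrt (2 * C) * b * 4 * (t * (704 * t ^ 3) ^ p)
          * (m : ℝ) ^ (1 / p - 1 / max p 2) * ‖x - y‖ := by rw [hB]; ring
      _ ≤ Real.sqrt (2 * C) * b * 4 * (704 ^ p * (2 ^ (4 * p) * entryNorm A μ ^ (4 * p)))
          * (m : ℝ) ^ (1 / p - 1 / max p 2) * ‖x - y‖ := by gcongr
      _ = _ := by ring
  · rw [mul_pow, Real.sq_sqrt (by linarith)]
    exact key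

end Processes

end LpDeviation

/-! ### The two processes; the factor `4` in the constant is needed only for centring `X`. -/

theorem theorem3p4 (p : ℝ) (hp : 1 ≤ p) (q : ℝ≥0∞)
    (hpq : ENNReal.HolderConjugate (ENNReal.ofReal p) q) :
    ∃ C : ℝ, 0 < C ∧
      ∀ {Ω : Type*} [MeasurableSpace Ω] (μ : Measure Ω) [IsProbabilityMeasure μ]
        (m n : ℕ) [NeZero m] [NeZero n] (A : Ω → Matrix (Fin m) (Fin n) ℝ),
        LpDeviation.IsIIDSubGaussianMatrix A μ →
        ∀ x ∈ LpDeviation.rowSphere p A μ, ∀ y ∈ LpDeviation.rowSphere p A μ,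
          LpDeviation.orliczNorm 2
              (fun ω => LpDeviation.procR p A μ x ω - LpDeviation.procR p A μ y ω) μ
            ≤ ENNReal.ofReal (C * LpDeviation.entryNorm A μ ^ (4 * p)
                * LpDeviation.rad (LpDeviation.ellBall q m) * ‖x - y‖) ∧
          LpDeviation.orliczNorm 2
              (fun ω => LpDeviation.procX p A μ x ω - LpDeviation.procX p A μ y ω) μ
            ≤ ENNReal.ofReal (C * LpDeviation.entryNorm A μ ^ (4 * p)
                * LpDeviation.rad (LpDeviation.ellBall q m) * ‖x - y‖) := by
  open LpDeviation in
  have hp0 : 0 < p := by linarith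
  obtain ⟨C, hC, H⟩ := exists_lintegral_exp_increment_sq_le hp
  refine ⟨4 * C, by positivity, ?_⟩
  intro Ω _ μ _ m n _ _ A hA x hx y hy
  rcases eq_or_ne x y with rfl | hxy
  · simp only [sub_self, norm_zero, mul_zero, ENNReal.ofReal_zero, orliczNorm_two_zero, le_refl,
      and_self]
  obtain ⟨T, hT0, hT, hexp⟩ := H μ m n A hA x hx y hy hxy
  have hK : 0 ≤ entryNorm A μ := ENNReal.toReal_nonneg
  have hTle : 4 * T ≤ 4 * C * entryNorm A μ ^ (4 * p) * rad (ellBall q m) * ‖x - y‖ := by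
    have h1 : C * entryNorm A μ ^ (4 * p) * (m : ℝ) ^ (1 / p - 1 / max p 2) * ‖x - y‖
        ≤ C * entryNorm A μ ^ (4 * p) * rad (ellBall q m) * ‖x - y‖ := by
      gcongr
      exact rpow_le_rad_ellBall hp hpq
    linarith
  constructor
  · have e : (fun ω => procR p A μ x ω - procR p A μ y ω)
        = fun ω => ellNorm (ENNReal.ofReal p) ((A ω).mulVec x.ofLp)
          - ellNorm (ENNReal.ofReal p) ((A ω).mulVec y.ofLp) := by
      funext ω
      have h1 : rowNorm p A μ x = 1 := hx
      have h2 : rowNorm p A μ y = 1 := hy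
      simp only [procR, h1, h2]
      ring
    rw [e]
    exact (orliczNorm_two_le hT0 hexp).trans (ENNReal.ofReal_le_ofReal (by linarith))
  · have e : (fun ω => procX p A μ x ω - procX p A μ y ω)
        = fun ω => (ellNorm (ENNReal.ofReal p) ((A ω).mulVec x.ofLp)
            - ellNorm (ENNReal.ofReal p) ((A ω).mulVec y.ofLp))
          - ∫ ω', (ellNorm (ENNReal.ofReal p) ((A ω').mulVec x.ofLp)
            - ellNorm (ENNReal.ofReal p) ((A ω').mulVec y.ofLp)) ∂μ := by
      funext ω
      rw [integral_sub (integrable_ellNorm_mulVec hA hp hx) (integrable_ellNorm_mulVec hA hp hy)]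
      simp only [procX]
      ring
    rw [e]
    refine (orliczNorm_two_le (by positivity) (lintegral_exp_sub_integral_sq_le
      ((measurable_ellNorm_mulVec hA hp0 x).sub (measurable_ellNorm_mulVec hA hp0 y))
      hT0 hexp)).trans (ENNReal.ofReal_le_ofReal hTle)
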